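/- Let $d>6$ and let $G$ be a lattice with vertex set $\mathbb{Z}^d$, i.e. a translation-invariant simple graph on $\mathbb{Z}^d$ whose edges have uniformly bounded Euclidean length. For $p\in[0,1]$, bond percolation $\mathbf{P}_p$ on $G$ keeps each edge (open) independently with probability $p$ and deletes it otherwise. Let $p_c=p_c(G)$ be the critical probability, the supremum of those $p\in[0,1]$ for which $\mathbf{P}_p$-almost surely all connected components of open edges are finite, and write $\mathbf{P}=\mathbf{P}_{p_c}$, with expectation $\mathbb{E}$. Write $x\leftrightarrow y$ if $x$ and $y$ are connected by an open path, and let $|\cdot|$ be the Euclidean norm, with the convention $0^{2-d}=1$. Assume the two-point function estimate: there are constants $c_1,c_2>0$ such that for all $x,y\in\mathbb{Z}^d$, $$c_1|x-y|^{2-d}\le \mathbf{P}(x\leftrightarrow y)\le c_2|x-y|^{2-d}.$$ Let $d_{\mathrm{int}}(x,y)\in\{0,1,2,\dots\}\cup\{\infty\}$ be the length of the shortest open path from $x$ to $y$ ($\infty$ if there is none), and for integers $r\ge 0$ put $$B(0,r)=\{u: d_{\mathrm{int}}(0,u)\le r\},\qquad \partial B(0,r)=\{u: d_{\mathrm{int}}(0,u)=r\},\qquad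 H(r)=\{\partial B(0,r)\neq\emptyset\}.$$ Then there is a constant $c>0$, depending only on $d$ and $G$, such that (i) $\mathbb{E}|B(0,r)|\ge c\,r$ for every integer $r\ge 0$; (ii) $\mathbf{P}(H(r))\ge c/r$ for every integer $r\ge 1$. -/

import Mathlib

open MeasureTheory ProbabilityTheory
open scoped ENNReal unitInterval

noncomputable section

namespace Perc

/-- The law of bond percolation on the graph `G` with parameter `p`: on `{0,1}^E`, where `E` is the
set of edges of `G`, the product of the measures giving `true` (the edge is open) mass `p` and
`false` (the edge is closed) mass `1 - p`. -/
def bondMeasure {V : Type*} (G : SimpleGraph V) (p : I) : Measure (G.edgeSet → Bool) :=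
  Measure.infinitePi fun _ : G.edgeSet => bernoulliMeasure true false p

/-- The random subgraph of `G` that consists of all vertices and of the open edges. -/
def openGraph {V : Type*} (G : SimpleGraph V) (ω : G.edgeSet → Bool) : SimpleGraph V :=
  SimpleGraph.fromEdgeSet {e | ∃ h : e ∈ G.edgeSet, ω ⟨e, h⟩ = true}

/-- The connected component (cluster) of `x` in the percolated graph. -/
def cluster {V : Type*} (G : SimpleGraph V) (ω : G.edgeSet → Bool) (x : V) : Set V :=
  {y | (openGraph G ω).Reachable x y}

/-- The critical probability: the supremum in `[0,1]` of the parameters at which almost surely all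
clusters are finite. The set contains `0`. -/
def criticalProb {V : Type*} (G : SimpleGraph V) : I :=
  sSup {p : I | ∀ᵐ ω ∂(bondMeasure G p), ∀ x : V, (cluster G ω x).Finite}

/-- The law of critical percolation on `G`. -/
def criticalMeasure {V : Type*} (G : SimpleGraph V) : Measure (G.edgeSet → Bool) :=
  bondMeasure G (criticalProb G)

/-- The intrinsic ball `B(x, r)`: the vertices at distance at most `r` from `x` in the
shortest-path metric of the percolated graph (unreachable vertices have distance `∞`). -/
def intrinsicBall {V : Type*} (G : SimpleGraph V) (ω : G.edgeSet → Bool) (x : V) (r : ℕ) : Set V :=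
  {u | (openGraph G ω).edist x u ≤ r}

/-- The intrinsic sphere `∂B(x, r)`. -/
def intrinsicSphere {V : Type*} (G : SimpleGraph V) (ω : G.edgeSet → Bool) (x : V) (r : ℕ) :
    Set V :=
  {u | (openGraph G ω).edist x u = r}

/-- The Euclidean norm of a point of `ℤ^d`. -/
def euclNorm {d : ℕ} (x : Fin d → ℤ) : ℝ :=
  ‖(WithLp.toLp 2 (fun i => (x i : ℝ)) : EuclideanSpace ℝ (Fin d))‖

/-- A lattice with vertex set `ℤ^d`: a translation invariant graph on `ℤ^d` whose edges have
bounded Euclidean length. It contains the nearest-neighbour and the spread-out lattices. -/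
structure IsLattice {d : ℕ} (G : SimpleGraph (Fin d → ℤ)) : Prop where
  translation : ∀ a x y : Fin d → ℤ, G.Adj (x + a) (y + a) ↔ G.Adj x y
  bounded_range : ∃ L : ℝ, ∀ x y : Fin d → ℤ, G.Adj x y → euclNorm (x - y) ≤ L

/-- The function `|x|^{2-d}` on `ℤ^d`, with the convention `0^{2-d} = 1`. -/
def powNorm {d : ℕ} (x : Fin d → ℤ) : ℝ :=
  if x = 0 then 1 else euclNorm x ^ (2 - (d : ℤ))

/-- The two-point function estimate: at criticality, the probability that `x` and `y` are connected
by an open path is `|x - y|^{2-d}` up to constants. -/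
def TwoPointEstimate {d : ℕ} (G : SimpleGraph (Fin d → ℤ)) : Prop :=
  ∃ c₁ c₂ : ℝ, 0 < c₁ ∧ 0 < c₂ ∧ ∀ x y : Fin d → ℤ,
    c₁ * powNorm (x - y) ≤ (criticalMeasure G).real {ω | (openGraph G ω).Reachable x y} ∧
    (criticalMeasure G).real {ω | (openGraph G ω).Reachable x y} ≤ c₂ * powNorm (x - y)

end Perc

end

/-! Let v(r) = E|B(0,r)| (`vol`). Both claims follow from two bounds on v; criticality enters only
through the two-point estimate.

Lower bound: every sphere has mean size at least 1. Given the ball of radius R, each vertex of the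
next sphere starts a connection off that ball, which is no likelier than an unconditional one. Hence
v(R+1+s) ≤ v(R) + g v(s), with g the mean size of the sphere of radius R+1 (`vol_add_le`). If g < 1,
iteration keeps v bounded, although the two-point function has infinite sum (`exists_lt_vol`,
`one_le_sph`). Summing over spheres gives (i).

Upper bound: v(r) ≤ C r for r ≥ 1 (`exists_vol_le`). Fix a suitable w and a walk of length l in G
from 0 to w. Then v(r)^2 is the sum over x, y of P(0 ↔ x) P(w+x ↔ y), with connections of length at
most r. With R = 2r + l, each product is at most the probability that both connections occur while y
is not in B(0,R), plus an error (`cp_mul_cp_le`). By the van den Berg–Kesten and tree-graph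
inequalities the errors sum to at most v(r)^2 times an open triangle, which is at most 1/2 because d
> 6 (`exists_small_triangle`). In the main term, opening the translated walk from x to w+x makes one
of its edges pivotal for y ∈ B(0,R), and a path of length at most R carries few pivotal edges. So
v(r)^2 ≤ K (R+1) v(R) (`vol_sq_le`). If v(r)/r were large, it would be squared, up to constants, at
each doubling of the radius, against polynomial volume growth (`linear_of_sq_le`).

For (ii), the annulus B(0,2r) \ B(0,r-1) has mean size at least r, second moment at most v(2r)^3 =
O(r^3), and is empty off H(r); the second moment method concludes (`le_measure_sphere`). -/

noncomputable section

namespace Perc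

/-! ### Products of Bernoulli measures -/

section Product

variable {E : Type*}

/-- The product over `E` of the Bernoulli measures with parameter `p`. -/
def prodBer (E : Type*) (p : I) : Measure (E → Bool) :=
  Measure.infinitePi fun _ : E => bernoulliMeasure true false p

instance (p : I) : IsProbabilityMeasure (prodBer E p) := by
  unfold prodBer; infer_instance

open Classical in
/-- The configuration that agrees with `ω` on `U` and with `ω'` off `U`. -/
def mix (U : Set E) (ω ω' : E → Bool) : E → Bool := fun e => if e ∈ U then ω e else ω' e

lemma measurable_mix (U : Set E) :
    Measurable fun q : (E → Bool) × (E → Bool) => mix U q.1 q.2 := by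
  classical
  refine measurable_pi_lambda _ fun e => ?_
  by_cases h : e ∈ U
  · simp only [mix, h, if_true]; fun_prop
  · simp only [mix, h, if_false]; fun_prop

/-- Source of both independence on disjoint coordinates and, with `U` the complement of `{e}`,
resampling of a single coordinate. -/
lemma map_mix (p : I) (U : Set E) :
    ((prodBer E p).prod (prodBer E p)).map (fun q => mix U q.1 q.2) = prodBer E p := by
  classical
  refine Measure.eq_infinitePi _ fun s t ht => ?_
  rw [Measure.map_apply (measurable_mix U) (.pi s.countable_toSet fun _ _ => ht _)]
  have : (fun q : (E → Bool) × (E → Bool) => mix U q.1 q.2) ⁻¹' (Set.pi (s : Set E) t) =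
      (Set.pi ((s.filter (· ∈ U) : Finset E) : Set E) t) ×ˢ
        (Set.pi ((s.filter (· ∉ U) : Finset E) : Set E) t) := by
    ext q
    simp only [Set.mem_preimage, Set.mem_pi, Set.mem_prod, Finset.coe_filter, Set.mem_ofPred_eq,
      Finset.mem_coe, mix]
    constructor
    · intro h
      exact ⟨fun i hi => by simpa [hi.2] using h i hi.1, fun i hi => by simpa [hi.2] using h i hi.1⟩
    · intro h i hi
      split_ifs with hU
      · exact h.1 i ⟨hi, hU⟩
      · exact h.2 i ⟨hi, hU⟩
  rw [this, Measure.prod_prod, prodBer, Measure.infinitePi_pi _ fun i _ => ht i,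
    Measure.infinitePi_pi _ fun i _ => ht i, Finset.prod_filter_mul_prod_filter_not]

/-- Events that depend on disjoint sets of coordinates are independent. -/
lemma prodBer_inter_of_dependsOn (p : I) (U : Set E) {A B : Set (E → Bool)}
    (hA : MeasurableSet A) (hB : MeasurableSet B)
    (hAU : DependsOn (fun ω => ω ∈ A) U) (hBU : DependsOn (fun ω => ω ∈ B) Uᶜ) :
    prodBer E p (A ∩ B) = prodBer E p A * prodBer E p B := by
  conv_lhs => rw [← map_mix p U]
  rw [Measure.map_apply (measurable_mix U) (hA.inter hB), ← Measure.prod_prod]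
  congr 1
  ext ⟨ω, ω'⟩
  have h1 : (mix U ω ω' ∈ A) = (ω ∈ A) := hAU fun e he => by simp [mix, he]
  have h2 : (mix U ω ω' ∈ B) = (ω' ∈ B) := hBU fun e he => by
    simp only [Set.mem_compl_iff] at he; simp [mix, he]
  simp only [Set.mem_preimage, Set.mem_inter_iff, Set.mem_prod, h1, h2]

/-- The probability that an edge is open, as an extended nonnegative real. -/
def op (p : I) : ℝ≥0∞ := ENNReal.ofReal p

/-- The probability that an edge is closed, as an extended nonnegative real. -/
def cl (p : I) : ℝ≥0∞ := ENNReal.ofReal (1 - p)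

lemma op_add_cl (p : I) : op p + cl p = 1 := by
  rw [op, cl, ← ENNReal.ofReal_add p.2.1 (by linarith [p.2.2])]; simp

lemma measurable_updateBool [DecidableEq E] (e : E) (b : Bool) :
    Measurable fun ω : E → Bool => Function.update ω e b :=
  measurable_update_left

lemma lintegral_ber (p : I) (φ : Bool → ℝ≥0∞) :
    ∫⁻ b, φ b ∂(bernoulliMeasure true false p) = op p * φ true + cl p * φ false := by
  have h1 : ((unitInterval.toNNReal p : NNReal) : ℝ≥0∞) = op p := by
    rw [op, ENNReal.ofReal]; congr 1; ext; simp [p.2.1]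
  have h2 : ((unitInterval.toNNReal (unitInterval.symm p) : NNReal) : ℝ≥0∞) = cl p := by
    rw [cl, ENNReal.ofReal]; congr 1; ext; simp [p.2.2]
  rw [bernoulliMeasure_def, lintegral_add_measure, lintegral_smul_measure, lintegral_smul_measure,
    lintegral_dirac, lintegral_dirac, ENNReal.smul_def, ENNReal.smul_def, h1, h2]
  rfl

/-- Resampling one coordinate. -/
lemma lintegral_resample [DecidableEq E] (p : I) (e : E) {φ : (E → Bool) → ℝ≥0∞}
    (hφ : Measurable φ) :
    ∫⁻ ω, φ ω ∂(prodBer E p) =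
      ∫⁻ ω, (op p * φ (Function.update ω e true) + cl p * φ (Function.update ω e false))
        ∂(prodBer E p) := by
  conv_lhs => rw [← map_mix p {e}ᶜ]
  have hm := measurable_mix (E := E) {e}ᶜ
  have hc : Measurable fun q : (E → Bool) × (E → Bool) => φ (mix {e}ᶜ q.1 q.2) := hφ.comp hm
  rw [lintegral_map hφ hm, lintegral_prod _ hc.aemeasurable]
  refine lintegral_congr fun ω => ?_
  have : ∀ ω' : E → Bool, mix {e}ᶜ ω ω' = Function.update ω e (ω' e) := by
    intro ω'; ext f
    by_cases h : f = e
    · subst h; simp [mix]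
    · simp [mix, h]
  simp only [this]
  rw [← lintegral_ber p fun b => φ (Function.update ω e b)]
  rw [← Measure.infinitePi_map_eval (fun _ : E => bernoulliMeasure true false p) e,
    lintegral_map (measurable_of_countable _) (measurable_pi_apply e)]
  rfl

/-- Resampling the same coordinate in two independent copies. -/
lemma lintegral_resample_prod [DecidableEq E] (p : I) (e : E)
    {φ : (E → Bool) × (E → Bool) → ℝ≥0∞} (hφ : Measurable φ) :
    ∫⁻ q, φ q ∂((prodBer E p).prod (prodBer E p)) =
      ∫⁻ q,
        (op p * (op p * φ (Function.update q.1 e true, Function.update q.2 e true) +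
            cl p * φ (Function.update q.1 e true, Function.update q.2 e false)) +
          cl p * (op p * φ (Function.update q.1 e false, Function.update q.2 e true) +
            cl p * φ (Function.update q.1 e false, Function.update q.2 e false)))
        ∂((prodBer E p).prod (prodBer E p)) := by
  have hu := measurable_updateBool (E := E) e
  have hm : ∀ b c, Measurable fun q : (E → Bool) × (E → Bool) =>
      φ (Function.update q.1 e b, Function.update q.2 e c) := fun b c =>
    hφ.comp (((hu b).comp measurable_fst).prodMk ((hu c).comp measurable_snd))
  rw [lintegral_prod _ hφ.aemeasurable,
    lintegral_prod _ (Measurable.aemeasurable (by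
      have := hm true true; have := hm true false; have := hm false true
      have := hm false false; fun_prop))]
  rw [lintegral_resample p e hφ.lintegral_prod_right']
  refine lintegral_congr fun ω => ?_
  have hω : ∀ ω : E → Bool, Measurable fun ω' => φ (ω, ω') := fun ω => hφ.comp measurable_prodMk_left
  have hω' : ∀ (ω : E → Bool) (c : Bool), Measurable fun ω' => φ (ω, Function.update ω' e c) :=
    fun ω c => (hω ω).comp (hu c)
  have hr : ∀ ω : E → Bool, Measurable fun ω' : E → Bool =>
      op p * φ (ω, Function.update ω' e true) + cl p * φ (ω, Function.update ω' e false) :=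
    fun ω => ((hω' ω true).const_mul _).add ((hω' ω false).const_mul _)
  rw [lintegral_resample p e (hω (Function.update ω e true)),
    lintegral_resample p e (hω (Function.update ω e false)),
    ← lintegral_const_mul _ (hr _), ← lintegral_const_mul _ (hr _),
    ← lintegral_add_left ((hr _).const_mul _)]

/-- Opening a coordinate costs at most the factor `op p`. -/
lemma op_mul_prodBer_update_le [DecidableEq E] (p : I) (e : E) {Q : Set (E → Bool)}
    (hQ : MeasurableSet Q) :
    op p * prodBer E p {ω | Function.update ω e true ∈ Q} ≤ prodBer E p Q := by
  have hm : MeasurableSet {ω : E → Bool | Function.update ω e true ∈ Q} :=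
    measurable_updateBool e true hQ
  rw [← lintegral_indicator_one hQ, lintegral_resample p e (measurable_one.indicator hQ),
    ← lintegral_indicator_one hm, ← lintegral_const_mul _ (measurable_one.indicator hm)]
  exact lintegral_mono fun ω => le_add_right (le_of_eq (by rfl))

end Product

/-! ### The van den Berg–Kesten inequality -/

section BK

variable {E : Type*}

/-- The increasing event that all the coordinates of some member of `𝒜` are open. -/
def Up (𝒜 : Set (Finset E)) : Set (E → Bool) := {ω | ∃ S ∈ 𝒜, ∀ e ∈ S, ω e = true}

open Classical in
/-- The unions of disjoint members of two families: the family of disjoint occurrence. -/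
def disjOcc (𝒜 ℬ : Set (Finset E)) : Set (Finset E) :=
  {U | ∃ S ∈ 𝒜, ∃ T ∈ ℬ, Disjoint S T ∧ U = S ∪ T}

lemma mem_Up_disjOcc {𝒜 ℬ : Set (Finset E)} {ω : E → Bool} :
    ω ∈ Up (disjOcc 𝒜 ℬ) ↔ ∃ S ∈ 𝒜, ∃ T ∈ ℬ, Disjoint S T ∧ (∀ e ∈ S, ω e = true) ∧
      ∀ e ∈ T, ω e = true := by
  classical
  constructor
  · rintro ⟨_, ⟨S, hS, T, hT, hd, rfl⟩, h⟩
    exact ⟨S, hS, T, hT, hd, fun e he => h e (Finset.mem_union_left _ he),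
      fun e he => h e (Finset.mem_union_right _ he)⟩
  · rintro ⟨S, hS, T, hT, hd, h1, h2⟩
    refine ⟨S ∪ T, ⟨S, hS, T, hT, hd, rfl⟩, fun e he => ?_⟩
    rcases Finset.mem_union.1 he with he | he
    exacts [h1 e he, h2 e he]

lemma measurableSet_allOpen (S : Finset E) :
    MeasurableSet {ω : E → Bool | ∀ e ∈ S, ω e = true} := by
  have : {ω : E → Bool | ∀ e ∈ S, ω e = true} = ⋂ e ∈ S, {ω | ω e = true} := by ext; simp
  rw [this]
  exact Finset.measurableSet_biInter _ fun e _ =>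
    measurableSet_eq_fun (measurable_pi_apply e) measurable_const

lemma measurableSet_Up [Countable E] (𝒜 : Set (Finset E)) : MeasurableSet (Up 𝒜) := by
  have : Up 𝒜 = ⋃ S ∈ 𝒜, {ω : E → Bool | ∀ e ∈ S, ω e = true} := by ext; simp [Up]
  rw [this]
  exact MeasurableSet.biUnion (Set.to_countable _) fun S _ => measurableSet_allOpen S

open Classical in
/-- Disjoint occurrence when the coordinates in `F` are doubled: the second family uses the
second copy on `F`, and the two witnesses may overlap only there. -/
def splitOcc (𝒜 ℬ : Set (Finset E)) (F : Set E) : Set ((E → Bool) × (E → Bool)) :=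
  {q | ∃ S ∈ 𝒜, ∃ T ∈ ℬ, (∀ e ∈ S, e ∈ T → e ∈ F) ∧ (∀ e ∈ S, q.1 e = true) ∧
    ∀ e ∈ T, mix F q.2 q.1 e = true}

lemma measurableSet_splitOcc [Countable E] (𝒜 ℬ : Set (Finset E)) (F : Set E) :
    MeasurableSet (splitOcc 𝒜 ℬ F) := by
  have : splitOcc 𝒜 ℬ F = ⋃ S ∈ 𝒜, ⋃ T ∈ {T ∈ ℬ | ∀ e ∈ S, e ∈ T → e ∈ F},
      (Prod.fst ⁻¹' {ω : E → Bool | ∀ e ∈ S, ω e = true}) ∩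
        ((fun q : (E → Bool) × (E → Bool) => mix F q.2 q.1) ⁻¹'
          {ω : E → Bool | ∀ e ∈ T, ω e = true}) := by
    ext q
    simp only [splitOcc, Set.mem_iUnion, Set.mem_ofPred_eq, Set.mem_inter_iff, Set.mem_preimage,
      exists_prop, and_assoc]
  rw [this]
  refine MeasurableSet.biUnion (Set.to_countable _) fun S _ =>
    MeasurableSet.biUnion (Set.to_countable _) fun T _ => ?_
  exact (measurable_fst (measurableSet_allOpen S)).inter
    (((measurable_mix F).comp measurable_swap) (measurableSet_allOpen T))

/-- With the other coordinates fixed, at most one of the two witnesses needs `e`, and it may read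
`e` off either copy because both are open with probability `op p`. -/
lemma splitOcc_le_insert [Countable E] (p : I) (𝒜 ℬ : Set (Finset E)) {F : Set E} {e : E}
    (he : e ∉ F) :
    (prodBer E p).prod (prodBer E p) (splitOcc 𝒜 ℬ F) ≤
      (prodBer E p).prod (prodBer E p) (splitOcc 𝒜 ℬ (insert e F)) := by
  classical
  have hm := measurableSet_splitOcc 𝒜 ℬ
  rw [← lintegral_indicator_one (hm F), ← lintegral_indicator_one (hm (insert e F)),
    lintegral_resample_prod p e (measurable_one.indicator (hm F)),
    lintegral_resample_prod p e (measurable_one.indicator (hm (insert e F)))]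
  refine lintegral_mono fun q => ?_
  set u : Bool → Bool → Prop := fun x y =>
    (Function.update q.1 e x, Function.update q.2 e y) ∈ splitOcc 𝒜 ℬ F with hu
  set v : Bool → Bool → Prop := fun x y =>
    (Function.update q.1 e x, Function.update q.2 e y) ∈ splitOcc 𝒜 ℬ (insert e F) with hv
  have hmixF : ∀ (x y : Bool) (f : E), f ≠ e →
      mix F (Function.update q.2 e y) (Function.update q.1 e x) f = mix F q.2 q.1 f := by
    intro x y f hf; simp [mix, hf]
  have hmixFe : ∀ (x y : Bool),
      mix F (Function.update q.2 e y) (Function.update q.1 e x) e = x := by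
    intro x y; simp [mix, he]
  have hmixI : ∀ (x y : Bool) (f : E), f ≠ e →
      mix (insert e F) (Function.update q.2 e y) (Function.update q.1 e x) f = mix F q.2 q.1 f := by
    intro x y f hf; simp [mix, hf]
  have hmixIe : ∀ (x y : Bool),
      mix (insert e F) (Function.update q.2 e y) (Function.update q.1 e x) e = y := by
    intro x y; simp [mix]
  -- Since `e ∉ F`, both witnesses read `e` from the first copy. If that is closed they avoid `e`,
  -- and neither copy matters after doubling.
  have key0 : ∀ y, u false y → ∀ x' y', v x' y' := by
    rintro y ⟨S, hS, T, hT, hST, h1, h2⟩ x' y'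
    have heS : ∀ f ∈ S, f ≠ e := by
      rintro f hf rfl; simpa using h1 f hf
    have heT : ∀ f ∈ T, f ≠ e := by
      rintro f hf rfl; simpa [hmixFe] using h2 f hf
    refine ⟨S, hS, T, hT, fun f hf hf' => Or.inr (hST f hf hf'), fun f hf => ?_, fun f hf => ?_⟩
    · have := h1 f hf
      simpa [heS f hf] using this
    · have := h2 f hf
      rw [hmixF _ _ _ (heT f hf)] at this
      change mix _ _ _ _ = _
      rw [hmixI _ _ _ (heT f hf), this]
  -- Before doubling the witnesses cannot share `e`, so after doubling at most one of the two copies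
  -- has to be open.
  have key1 : ∀ y, u true y → (∀ y', v true y') ∨ (∀ x', v x' true) := by
    rintro y ⟨S, hS, T, hT, hST, h1, h2⟩
    have hS1 : ∀ f ∈ S, f ≠ e → q.1 f = true := fun f hf hfe => by simpa [hfe] using h1 f hf
    have hT1 : ∀ f ∈ T, f ≠ e → mix F q.2 q.1 f = true := fun f hf hfe => by
      rw [← hmixF true y f hfe]; exact h2 f hf
    by_cases heT : e ∈ T
    · have heS : ∀ f ∈ S, f ≠ e := by rintro f hf rfl; exact he (hST f hf heT)
      refine Or.inr fun x' => ⟨S, hS, T, hT, fun f hf hf' => Or.inr (hST f hf hf'),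
        fun f hf => ?_, fun f hf => ?_⟩
      · simpa [heS f hf] using hS1 f hf (heS f hf)
      · by_cases hfe : f = e
        · subst hfe; exact hmixIe _ _
        · rw [hmixI _ _ _ hfe]; exact hT1 f hf hfe
    · refine Or.inl fun y' => ⟨S, hS, T, hT, fun f hf hf' => Or.inr (hST f hf hf'),
        fun f hf => ?_, fun f hf => ?_⟩
      · by_cases hfe : f = e
        · subst hfe; simp
        · simpa [hfe] using hS1 f hf hfe
      · have hfe : f ≠ e := by rintro rfl; exact heT hf
        change mix _ _ _ _ = _
        rw [hmixI _ _ _ hfe]; exact hT1 f hf hfe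
  have hi : ∀ x y, (splitOcc 𝒜 ℬ F).indicator (1 : (E → Bool) × (E → Bool) → ℝ≥0∞)
      (Function.update q.1 e x, Function.update q.2 e y) = if u x y then 1 else 0 := by
    intro x y; simp [Set.indicator_apply, hu]
  have hi' : ∀ x y, (splitOcc 𝒜 ℬ (insert e F)).indicator (1 : (E → Bool) × (E → Bool) → ℝ≥0∞)
      (Function.update q.1 e x, Function.update q.2 e y) = if v x y then 1 else 0 := by
    intro x y; simp [Set.indicator_apply, hv]
  simp only [hi, hi']
  have hle : ∀ (P : Prop), (if P then (1 : ℝ≥0∞) else 0) ≤ 1 := by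
    intro P; split_ifs <;> simp
  have hab := op_add_cl p
  by_cases h0 : ∃ y, u false y
  · obtain ⟨y, hy⟩ := h0
    have := key0 y hy
    simp only [this, if_true]
    gcongr <;> exact hle _
  · simp only [not_exists] at h0
    simp only [h0, if_false, mul_zero, add_zero]
    by_cases h1 : ∃ y, u true y
    · obtain ⟨y, hy⟩ := h1
      calc op p * (op p * (if u true true then 1 else 0) + cl p * (if u true false then 1 else 0))
          ≤ op p * (op p * 1 + cl p * 1) := by gcongr <;> exact hle _
        _ = op p := by rw [mul_one, mul_one, hab, mul_one]
        _ ≤ _ := by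
          rcases key1 y hy with h | h
          · simp only [h, if_true, mul_one, hab]; exact le_self_add
          · simp only [h, if_true, mul_one]
            calc op p = op p * (op p + cl p) := by rw [hab, mul_one]
              _ = op p * op p + cl p * op p := by rw [mul_add, mul_comm (op p) (cl p)]
              _ ≤ _ := by gcongr <;> exact le_self_add
    · simp only [not_exists] at h1
      simp [h1]

/-- A finite `ℬ` involves finitely many coordinates. Once all of them are doubled, one at a time,
the two witnesses live on independent copies. -/
lemma bk_of_finite [Countable E] (p : I) (𝒜 : Set (Finset E)) {ℬ : Set (Finset E)} (hℬ : ℬ.Finite) :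
    prodBer E p (Up (disjOcc 𝒜 ℬ)) ≤ prodBer E p (Up 𝒜) * prodBer E p (Up ℬ) := by
  classical
  set μ := prodBer E p
  have hmono : ∀ F : Finset E, (μ.prod μ) (splitOcc 𝒜 ℬ ∅) ≤ (μ.prod μ) (splitOcc 𝒜 ℬ F) := by
    intro F
    induction F using Finset.induction_on with
    | empty => simp
    | insert e F he ih =>
      rw [Finset.coe_insert]
      exact ih.trans (splitOcc_le_insert p 𝒜 ℬ (by simpa using he))
  set F : Finset E := hℬ.toFinset.biUnion id
  have h1 : (μ.prod μ) (splitOcc 𝒜 ℬ ∅) = μ (Up (disjOcc 𝒜 ℬ)) := by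
    have : splitOcc 𝒜 ℬ ∅ = Up (disjOcc 𝒜 ℬ) ×ˢ Set.univ := by
      ext q
      simp [splitOcc, mem_Up_disjOcc, mix, Finset.disjoint_left]
    rw [this, Measure.prod_prod, measure_univ, mul_one]
  have h2 : splitOcc 𝒜 ℬ F ⊆ Up 𝒜 ×ˢ Up ℬ := by
    rintro q ⟨S, hS, T, hT, -, hq1, hq2⟩
    refine ⟨⟨S, hS, hq1⟩, ⟨T, hT, fun e he => ?_⟩⟩
    have : e ∈ F := Finset.mem_biUnion.2 ⟨T, by simpa using hT, he⟩
    simpa [mix, this] using hq2 e he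
  rw [← h1, ← Measure.prod_prod]
  exact (hmono F).trans (measure_mono h2)

/-- The van den Berg–Kesten inequality. -/
theorem bk [Countable E] (p : I) (𝒜 ℬ : Set (Finset E)) :
    prodBer E p (Up (disjOcc 𝒜 ℬ)) ≤ prodBer E p (Up 𝒜) * prodBer E p (Up ℬ) := by
  have := Encodable.ofCountable (Finset E)
  -- Exhaust `ℬ` by finite subfamilies; disjoint occurrence is the increasing union.
  set t : Set (Finset E) → ℕ → Set (Finset E) := fun 𝒞 n => {S ∈ 𝒞 | Encodable.encode S < n}
  have hfin : ∀ 𝒞 n, (t 𝒞 n).Finite := fun 𝒞 n =>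
    Set.Finite.subset (Set.Finite.preimage Encodable.encode_injective.injOn (Set.finite_lt_nat n))
      fun S hS => hS.2
  have hsub : ∀ 𝒞 n, Up (t 𝒞 n) ⊆ Up 𝒞 := fun 𝒞 n ω ⟨S, hS, h⟩ => ⟨S, hS.1, h⟩
  have hU : Up (disjOcc 𝒜 ℬ) = ⋃ n, Up (disjOcc 𝒜 (t ℬ n)) := by
    ext ω
    simp only [Set.mem_iUnion, mem_Up_disjOcc]
    constructor
    · rintro ⟨S, hS, T, hT, h⟩
      exact ⟨Encodable.encode T + 1, S, hS, T, ⟨hT, by omega⟩, h⟩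
    · rintro ⟨n, S, hS, T, hT, h⟩
      exact ⟨S, hS, T, hT.1, h⟩
  have hmono : Monotone fun n => Up (disjOcc 𝒜 (t ℬ n)) := by
    intro m n hmn ω
    simp only [mem_Up_disjOcc]
    rintro ⟨S, hS, T, hT, h⟩
    exact ⟨S, hS, T, ⟨hT.1, hT.2.trans_le hmn⟩, h⟩
  rw [hU, hmono.measure_iUnion]
  refine iSup_le fun n => (bk_of_finite p 𝒜 (hfin _ n)).trans ?_
  exact mul_le_mul' le_rfl (measure_mono (hsub _ n))

end BK

/-! ### Connections by short open paths -/

section Connections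

variable {V : Type*} {G : SimpleGraph V}

/-- All edges of the walk are open. -/
def OpenWalk (ω : G.edgeSet → Bool) {u v : V} (p : G.Walk u v) : Prop :=
  ∀ e : G.edgeSet, (e : Sym2 V) ∈ p.edges → ω e = true

lemma OpenWalk.of_subset {ω : G.edgeSet → Bool} {u v u' v' : V} {p : G.Walk u v}
    {q : G.Walk u' v'} (hp : OpenWalk ω p) (h : q.edges ⊆ p.edges) : OpenWalk ω q :=
  fun e he => hp e (h he)

lemma OpenWalk.append {ω : G.edgeSet → Bool} {u v w : V} {p : G.Walk u v}
    {q : G.Walk v w} (hp : OpenWalk ω p) (hq : OpenWalk ω q) : OpenWalk ω (p.append q) := by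
  intro e he
  rw [SimpleGraph.Walk.edges_append, List.mem_append] at he
  exact he.elim (hp e) (hq e)

lemma OpenWalk.mono {ω ω' : G.edgeSet → Bool} (h : ∀ e, ω e = true → ω' e = true) {u v : V}
    {p : G.Walk u v} (hp : OpenWalk ω p) : OpenWalk ω' p :=
  fun e he => h e (hp e he)

variable (G) in
/-- The event that `u` and `v` are connected by an open path of length at most `r` that
avoids `A`. -/
def conn (A : Set V) (r : ℕ) (u v : V) : Set (G.edgeSet → Bool) :=
  {ω | ∃ p : G.Walk u v, p.length ≤ r ∧ (∀ z ∈ p.support, z ∉ A) ∧ OpenWalk ω p}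

open Classical in
/-- The set of edges of a walk. -/
def walkEdges {u v : V} (p : G.Walk u v) : Finset G.edgeSet :=
  Finset.subtype (· ∈ G.edgeSet) p.edges.toFinset

@[simp] lemma mem_walkEdges {u v : V} (p : G.Walk u v) (e : G.edgeSet) :
    e ∈ walkEdges p ↔ (e : Sym2 V) ∈ p.edges := by
  simp [walkEdges]

variable (G) in
/-- The edge sets of the walks of length at most `r` from `u` to `v` that avoid `A`. -/
def fam (A : Set V) (r : ℕ) (u v : V) : Set (Finset G.edgeSet) :=
  {S | ∃ p : G.Walk u v, p.length ≤ r ∧ (∀ z ∈ p.support, z ∉ A) ∧ S = walkEdges p}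

lemma walkEdges_mem_fam {r : ℕ} {u v : V} {p : G.Walk u v} (hp : p.length ≤ r) :
    walkEdges p ∈ fam G ∅ r u v :=
  ⟨p, hp, by simp, rfl⟩

lemma Up_fam (A : Set V) (r : ℕ) (u v : V) : Up (fam G A r u v) = conn G A r u v := by
  ext ω
  constructor
  · rintro ⟨_, ⟨p, hp, hA, rfl⟩, h⟩
    exact ⟨p, hp, hA, fun e he => h e (by simpa using he)⟩
  · rintro ⟨p, hp, hA, h⟩
    exact ⟨_, ⟨p, hp, hA, rfl⟩, fun e he => h e (by simpa using he)⟩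

lemma measurableSet_conn [Countable V] (A : Set V) (r : ℕ) (u v : V) :
    MeasurableSet (conn G A r u v) := by
  have : Countable (Sym2 V) := Quotient.countable
  rw [← Up_fam]; exact measurableSet_Up _

lemma conn_comm (A : Set V) (r : ℕ) (u v : V) : conn G A r u v = conn G A r v u := by
  have : ∀ u v, conn G A r u v ⊆ conn G A r v u := by
    rintro u v ω ⟨p, hp, hA, h⟩
    exact ⟨p.reverse, by simpa using hp, by simpa using hA,
      h.of_subset (by simp)⟩
  exact (this u v).antisymm (this v u)

lemma conn_mono_length {A : Set V} {r s : ℕ} (h : r ≤ s) (u v : V) :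
    conn G A r u v ⊆ conn G A s u v :=
  fun _ ⟨p, hp, h'⟩ => ⟨p, hp.trans h, h'⟩

lemma conn_subset_empty (A : Set V) (r : ℕ) (u v : V) : conn G A r u v ⊆ conn G ∅ r u v :=
  fun _ ⟨p, hp, _, h⟩ => ⟨p, hp, by simp, h⟩

lemma conn_mono_config {A : Set V} {r : ℕ} {u v : V} {ω ω' : G.edgeSet → Bool}
    (h : ∀ e, ω e = true → ω' e = true) (hω : ω ∈ conn G A r u v) : ω' ∈ conn G A r u v :=
  let ⟨p, hp, hA, ho⟩ := hω
  ⟨p, hp, hA, ho.mono h⟩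

lemma conn_trans {r s : ℕ} {u v w : V} {ω : G.edgeSet → Bool}
    (h₁ : ω ∈ conn G ∅ r u v) (h₂ : ω ∈ conn G ∅ s v w) : ω ∈ conn G ∅ (r + s) u w := by
  obtain ⟨p, hp, -, ho⟩ := h₁
  obtain ⟨q, hq, -, ho'⟩ := h₂
  exact ⟨p.append q, by simp; omega, by simp, ho.append ho'⟩

lemma mem_conn_self {A : Set V} {u : V} (hu : u ∉ A) (r : ℕ) (ω : G.edgeSet → Bool) :
    ω ∈ conn G A r u u :=
  ⟨.nil, by simp, by simpa using hu, by simp [OpenWalk]⟩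

lemma conn_notMem_right {A : Set V} {r : ℕ} {u v : V} {ω : G.edgeSet → Bool}
    (h : ω ∈ conn G A r u v) : v ∉ A :=
  let ⟨p, _, hA, _⟩ := h
  hA _ p.end_mem_support

lemma conn_zero {u v : V} {ω : G.edgeSet → Bool} : ω ∈ conn G ∅ 0 u v ↔ u = v := by
  constructor
  · rintro ⟨p, hp, -⟩
    exact SimpleGraph.Walk.eq_of_length_eq_zero (Nat.le_zero.1 hp)
  · rintro rfl; exact mem_conn_self (by simp) _ _

lemma conn_succ {A : Set V} {r : ℕ} {u y : V} {ω : G.edgeSet → Bool} :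
    ω ∈ conn G A (r + 1) u y ↔ ω ∈ conn G A r u y ∨
      ∃ v, ω ∈ conn G A r u v ∧ y ∉ A ∧ ∃ h : G.Adj v y, ω ⟨s(v, y), h⟩ = true := by
  constructor
  · rintro ⟨p, hp, hA, ho⟩
    cases p with
    | nil => exact Or.inl ⟨.nil, by simp, hA, ho⟩
    | cons h q =>
      obtain ⟨v, q', h', heq⟩ := SimpleGraph.Walk.exists_cons_eq_concat h q
      rw [heq] at hp hA ho
      refine Or.inr ⟨v, ⟨q', ?_, ?_, ?_⟩, ?_, h', ?_⟩
      · simpa using hp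
      · intro z hz; exact hA z (by simp [SimpleGraph.Walk.support_concat, hz])
      · exact ho.of_subset (by simp [SimpleGraph.Walk.edges_concat])
      · exact hA y (by simp [SimpleGraph.Walk.support_concat])
      · exact ho ⟨s(v, y), h'⟩ (by simp [SimpleGraph.Walk.edges_concat])
  · rintro (h | ⟨v, ⟨p, hp, hA, ho⟩, hy, h, hv⟩)
    · exact conn_mono_length (Nat.le_succ r) u y h
    · refine ⟨p.concat h, by simpa using hp, ?_, ?_⟩
      · intro z hz
        simp only [SimpleGraph.Walk.support_concat, List.mem_append, List.mem_singleton] at hz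
        rcases hz with hz | rfl
        exacts [hA z hz, hy]
      · intro e he
        simp only [SimpleGraph.Walk.edges_concat, List.concat_eq_append,
          List.mem_append, List.mem_singleton] at he
        rcases he with he | he
        · exact ho e he
        · have : e = ⟨s(v, y), h⟩ := Subtype.ext he
          rw [this, hv]

lemma exists_isPath_of_conn {r : ℕ} {u v : V} {ω : G.edgeSet → Bool}
    (h : ω ∈ conn G ∅ r u v) : ∃ p : G.Walk u v, p.IsPath ∧ p.length ≤ r ∧ OpenWalk ω p := by
  classical
  obtain ⟨p, hp, -, ho⟩ := h
  exact ⟨p.bypass, p.bypass_isPath, p.length_bypass_le_length.trans hp,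
    ho.of_subset p.edges_bypass_subset_edges⟩

lemma disjoint_walkEdges {u v u' v' : V} {p : G.Walk u v} {q : G.Walk u' v'}
    (h : ∀ e, e ∈ p.edges → e ∉ q.edges) : Disjoint (walkEdges p) (walkEdges q) := by
  rw [Finset.disjoint_left]
  intro e he he'
  exact h e (by simpa using he) (by simpa using he')

/-- A short open path that meets `A` splits into two disjoint open paths at a point of `A`. -/
lemma conn_diff_subset (A : Set V) (r : ℕ) (u y : V) :
    conn G ∅ r u y \ conn G A r u y ⊆
      ⋃ a ∈ A, Up (disjOcc (fam G ∅ r u a) (fam G ∅ r a y)) := by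
  classical
  rintro ω ⟨h, h'⟩
  obtain ⟨p, hp, hl, ho⟩ := exists_isPath_of_conn h
  have : ∃ a ∈ p.support, a ∈ A := by
    by_contra hcon
    push Not at hcon
    exact h' ⟨p, hl, hcon, ho⟩
  obtain ⟨a, ha, haA⟩ := this
  simp only [Set.mem_iUnion]
  refine ⟨a, haA, mem_Up_disjOcc.2 ⟨walkEdges (p.takeUntil a ha), ?_, walkEdges (p.dropUntil a ha),
    ?_, ?_, ?_, ?_⟩⟩
  · exact walkEdges_mem_fam ((p.length_takeUntil_le_length ha).trans hl)
  · exact walkEdges_mem_fam ((p.length_dropUntil_le_length ha).trans hl)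
  · refine disjoint_walkEdges fun e he he' => ?_
    exact (hp.isTrail.disjoint_edges_takeUntil_dropUntil ha) he he'
  · intro e he
    exact ho e (p.edges_takeUntil_subset_edges ha (by simpa using he))
  · intro e he
    exact ho e (p.edges_dropUntil_subset_edges ha (by simpa using he))

/-- Two open paths from `u` contain a tripod of disjoint open paths. -/
lemma conn_inter_subset (r s : ℕ) (u x a : V) :
    conn G ∅ r u x ∩ conn G ∅ s u a ⊆
      ⋃ z, Up (disjOcc (fam G ∅ r u z) (disjOcc (fam G ∅ r z x) (fam G ∅ s z a))) := by
  classical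
  rintro ω ⟨h, h'⟩
  obtain ⟨p, hp, hl, ho⟩ := exists_isPath_of_conn h
  obtain ⟨q₀, hq₀, -, hoq₀⟩ := h'
  -- A shortest open walk from a vertex of `p` to `a` meets `p` only at its start, hence shares no
  -- edge with `p`.
  let P : ℕ → Prop := fun n => ∃ z ∈ p.support, ∃ q : G.Walk z a, q.length = n ∧ OpenWalk ω q
  have hex : ∃ n, P n := ⟨_, u, p.start_mem_support, q₀, rfl, hoq₀⟩
  obtain ⟨z, hz, q, hq, hoq⟩ := Nat.find_spec hex
  have hqs : q.length ≤ s := by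
    rw [hq]; exact (Nat.find_le ⟨u, p.start_mem_support, q₀, rfl, hoq₀⟩).trans hq₀
  have hfirst : ∀ w ∈ q.support, w ∈ p.support → w = z := by
    intro w hw hwp
    by_contra hne
    have h1 : Nat.find hex ≤ (q.dropUntil w hw).length :=
      Nat.find_le ⟨w, hwp, q.dropUntil w hw, rfl,
        hoq.of_subset (q.edges_dropUntil_subset_edges hw)⟩
    have h2 : (q.takeUntil w hw).length + (q.dropUntil w hw).length = q.length := by
      rw [← SimpleGraph.Walk.length_append, SimpleGraph.Walk.take_spec]
    have h3 : (q.takeUntil w hw).length = 0 := by omega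
    exact hne (SimpleGraph.Walk.eq_of_length_eq_zero h3).symm
  have hdisj : ∀ e, e ∈ p.edges → e ∉ q.edges := by
    intro e
    induction e with | _ b c
    intro he he'
    have h1 := hfirst b (q.fst_mem_support_of_mem_edges he') (p.fst_mem_support_of_mem_edges he)
    have h2 := hfirst c (q.snd_mem_support_of_mem_edges he') (p.snd_mem_support_of_mem_edges he)
    exact (p.adj_of_mem_edges he).ne (h1.trans h2.symm)
  simp only [Set.mem_iUnion]
  have hT := p.edges_takeUntil_subset_edges hz
  have hD := p.edges_dropUntil_subset_edges hz
  refine ⟨z, mem_Up_disjOcc.2 ⟨walkEdges (p.takeUntil z hz),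
    walkEdges_mem_fam ((p.length_takeUntil_le_length hz).trans hl),
    walkEdges (p.dropUntil z hz) ∪ walkEdges q, ⟨walkEdges (p.dropUntil z hz),
      walkEdges_mem_fam ((p.length_dropUntil_le_length hz).trans hl), walkEdges q,
      walkEdges_mem_fam hqs, ?_, ?_⟩, ?_, ?_, ?_⟩⟩
  · exact disjoint_walkEdges fun e he => hdisj e (hD he)
  · ext; simp
  · rw [Finset.disjoint_union_right]
    exact ⟨disjoint_walkEdges fun e he he' =>
      (hp.isTrail.disjoint_edges_takeUntil_dropUntil hz) he he',
      disjoint_walkEdges fun e he => hdisj e (hT he)⟩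
  · intro e he
    exact ho e (hT (by simpa using he))
  · intro e he
    rcases Finset.mem_union.1 he with he | he
    · exact ho e (hD (by simpa using he))
    · exact hoq e (by simpa using he)

variable (G) in
/-- The probability that `u` and `v` are connected by an open path of length at most `r`. -/
def cp (p : I) (r : ℕ) (u v : V) : ℝ≥0∞ := prodBer G.edgeSet p (conn G ∅ r u v)

lemma cp_comm (p : I) (r : ℕ) (u v : V) : cp G p r u v = cp G p r v u := by
  rw [cp, conn_comm, cp]

lemma cp_le_one (p : I) (r : ℕ) (u v : V) : cp G p r u v ≤ 1 := prob_le_one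

lemma cp_mono (p : I) {r s : ℕ} (h : r ≤ s) (u v : V) : cp G p r u v ≤ cp G p s u v :=
  measure_mono (conn_mono_length h u v)

variable [Countable V]

instance countable_edgeSet : Countable G.edgeSet :=
  have : Countable (Sym2 V) := Quotient.countable
  inferInstance

lemma measure_conn_diff_le (p : I) (A : Set V) [DecidablePred (· ∈ A)] (r : ℕ) (u y : V) :
    prodBer G.edgeSet p (conn G ∅ r u y \ conn G A r u y) ≤
      ∑' a, if a ∈ A then cp G p r u a * cp G p r a y else 0 := by
  refine (measure_mono (conn_diff_subset A r u y)).trans ((measure_iUnion_le _).trans ?_)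
  refine ENNReal.tsum_le_tsum fun a => ?_
  split_ifs with h
  · simp only [h, Set.iUnion_true]
    refine (bk p _ _).trans ?_
    rw [Up_fam, Up_fam]; rfl
  · simp [h]

/-- The tree-graph inequality. -/
lemma measure_conn_inter_le (p : I) (r s : ℕ) (u x a : V) :
    prodBer G.edgeSet p (conn G ∅ r u x ∩ conn G ∅ s u a) ≤
      ∑' z, cp G p r u z * (cp G p r z x * cp G p s z a) := by
  refine (measure_mono (conn_inter_subset r s u x a)).trans ((measure_iUnion_le _).trans ?_)
  refine ENNReal.tsum_le_tsum fun z => ?_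
  refine (bk p _ _).trans (mul_le_mul' ?_ ((bk p _ _).trans (mul_le_mul' ?_ ?_)))
  all_goals rw [Up_fam]; rfl

end Connections

/-! ### Exploring an intrinsic ball -/

section Exploration

variable {V : Type*} {G : SimpleGraph V}

/-- The vertices connected to `u` by an open path of length at most `r`. -/
def iball (ω : G.edgeSet → Bool) (r : ℕ) (u : V) : Set V := {y | ω ∈ conn G ∅ r u y}

variable (G) in
/-- The edges that have an endpoint in `A`. -/
def touch (A : Set V) : Set G.edgeSet := {e | ∃ a ∈ A, a ∈ (e : Sym2 V)}

/-- Exploring the ball reads only edges that touch it: the last edge of a path of length at most `R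
+ 1` starts at a vertex of the ball. So distances up to `R + 1`, not just `R`, are determined. -/
lemma conn_iff_of_agree {A : Set V} {R : ℕ} {u : V} {ω ω' : G.edgeSet → Bool}
    (hA : iball ω R u = A) (h : ∀ e ∈ touch G A, ω e = ω' e) (k : ℕ) (hk : k ≤ R + 1) (y : V) :
    ω ∈ conn G ∅ k u y ↔ ω' ∈ conn G ∅ k u y := by
  induction k generalizing y with
  | zero => rw [conn_zero, conn_zero]
  | succ k ih =>
    have ih := ih (by omega)
    have key : ∀ v, ω ∈ conn G ∅ k u v → ∀ hv : G.Adj v y,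
        ω ⟨s(v, y), hv⟩ = ω' ⟨s(v, y), hv⟩ := fun v hv hvy => h _
      ⟨v, hA ▸ conn_mono_length (by omega) _ _ hv, by simp⟩
    rw [conn_succ, conn_succ, ih y]
    refine or_congr_right ⟨?_, ?_⟩
    · rintro ⟨v, hv, hy, hvy, ho⟩
      exact ⟨v, (ih v).1 hv, hy, hvy, by rw [← key v hv, ho]⟩
    · rintro ⟨v, hv, hy, hvy, ho⟩
      exact ⟨v, (ih v).2 hv, hy, hvy, by rw [key v ((ih v).2 hv), ho]⟩

lemma iball_eq_of_agree {A : Set V} {R : ℕ} {u : V} {ω ω' : G.edgeSet → Bool}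
    (hA : iball ω R u = A) (h : ∀ e ∈ touch G A, ω e = ω' e) : iball ω' R u = A := by
  rw [← hA]; ext y
  exact (conn_iff_of_agree hA h R (by omega) y).symm

lemma dependsOn_iball (A : Set V) (R : ℕ) (u : V) {S : Set (G.edgeSet → Bool)}
    (hS : ∀ ω ω', (∀ k ≤ R + 1, ∀ y, ω ∈ conn G ∅ k u y ↔ ω' ∈ conn G ∅ k u y) →
      ω ∈ S → ω' ∈ S) :
    DependsOn (fun ω => ω ∈ {ω : G.edgeSet → Bool | iball ω R u = A} ∩ S) (touch G A) := by
  have : ∀ ω ω' : G.edgeSet → Bool, (∀ e ∈ touch G A, ω e = ω' e) →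
      ω ∈ {ω : G.edgeSet → Bool | iball ω R u = A} ∩ S →
      ω' ∈ {ω : G.edgeSet → Bool | iball ω R u = A} ∩ S := fun ω ω' h hω =>
    ⟨iball_eq_of_agree hω.1 h, hS ω ω' (fun k hk y => conn_iff_of_agree hω.1 h k hk y) hω.2⟩
  exact fun ω ω' h => propext ⟨this ω ω' h, this ω' ω fun e he => (h e he).symm⟩

/-- A path avoiding `A` uses no edge that touches `A`. With `dependsOn_iball` this makes it
independent of the exploration that ends with the ball equal to `A`. -/
lemma dependsOn_conn (A : Set V) (r : ℕ) (u v : V) :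
    DependsOn (fun ω => ω ∈ conn G A r u v) (touch G A)ᶜ := by
  have : ∀ ω ω' : G.edgeSet → Bool, (∀ e ∈ (touch G A)ᶜ, ω e = ω' e) →
      ω ∈ conn G A r u v → ω' ∈ conn G A r u v := by
    rintro ω ω' h ⟨p, hp, hA, ho⟩
    refine ⟨p, hp, hA, fun e he => ?_⟩
    rw [← h e, ho e he]
    rintro ⟨a, ha, hae⟩
    exact hA a (p.mem_support_of_mem_edges he hae) ha
  exact fun ω ω' h => propext ⟨this ω ω' h, this ω' ω fun e he => (h e he).symm⟩

variable (G) in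
/-- The expected size of the intrinsic ball of radius `r` around `u`. -/
def vol (p : I) (r : ℕ) (u : V) : ℝ≥0∞ := ∑' y, cp G p r u y

lemma vol_mono (p : I) {r s : ℕ} (h : r ≤ s) (u : V) : vol G p r u ≤ vol G p s u :=
  ENNReal.tsum_le_tsum fun y => cp_mono p h u y

/-- On leaving the ball for the last time, a path steps onto a vertex `v` at distance exactly `R +
1`. It has then used at least `R + 1` edges, so at most `s` remain, all off the ball. -/
lemma exists_sphere_conn_off {ω : G.edgeSet → Bool} {R s : ℕ} {u y : V}
    (h : ω ∈ conn G ∅ (R + 1 + s) u y) (h' : ω ∉ conn G ∅ R u y) :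
    ∃ v, ω ∈ conn G ∅ (R + 1) u v \ conn G ∅ R u v ∧ ω ∈ conn G (iball ω R u) s v y := by
  induction s generalizing y with
  | zero => exact ⟨y, ⟨h, h'⟩, mem_conn_self (A := iball ω R u) h' 0 ω⟩
  | succ s ih =>
    rw [← add_assoc, conn_succ] at h
    rcases h with h | ⟨w, hw, -, hwy, ho⟩
    · obtain ⟨v, hv, hvy⟩ := ih h h'
      exact ⟨v, hv, conn_mono_length (Nat.le_succ s) _ _ hvy⟩
    · by_cases hwR : ω ∈ conn G ∅ R u w
      · refine ⟨y, ⟨conn_succ.2 (Or.inr ⟨w, hwR, by simp, hwy, ho⟩), h'⟩, mem_conn_self (A := iball ω R u) h' _ ω⟩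
      · obtain ⟨v, hv, hvw⟩ := ih hw hwR
        exact ⟨v, hv, conn_succ.2 (Or.inr ⟨w, hvw, h', hwy, ho⟩)⟩

variable [Countable V]

lemma measurableSet_iball_eq (A : Set V) (R : ℕ) (u : V) :
    MeasurableSet {ω : G.edgeSet → Bool | iball ω R u = A} := by
  classical
  have : {ω : G.edgeSet → Bool | iball ω R u = A} =
      ⋂ y, if y ∈ A then conn G ∅ R u y else (conn G ∅ R u y)ᶜ := by
    ext ω
    simp only [Set.mem_ofPred_eq, Set.mem_iInter, Set.ext_iff, iball]
    refine forall_congr' fun y => ?_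
    split_ifs with h <;> simp [h]
  rw [this]
  refine MeasurableSet.iInter fun y => ?_
  split_ifs
  exacts [measurableSet_conn _ _ _ _, (measurableSet_conn _ _ _ _).compl]

/-- Balls are finite, so partitioning by the value of the ball is a countable partition. -/
lemma measure_eq_tsum_iball (hfin : ∀ (ω : G.edgeSet → Bool) r u, (iball ω r u).Finite)
    (μ : Measure (G.edgeSet → Bool)) (R : ℕ) (u : V) {S : Set (G.edgeSet → Bool)}
    (hS : MeasurableSet S) :
    μ S = ∑' A : Finset V, μ ({ω | iball ω R u = A} ∩ S) := by
  rw [← measure_iUnion]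
  · congr 1
    ext ω
    simp only [Set.mem_iUnion, Set.mem_inter_iff, Set.mem_ofPred_eq, exists_and_right]
    exact ⟨fun h => ⟨⟨(hfin ω R u).toFinset, by simp⟩, h⟩, fun h => h.2⟩
  · intro A B hAB
    refine Set.disjoint_left.2 fun ω hA hB => hAB ?_
    exact Finset.coe_injective (hA.1.symm.trans hB.1)
  · exact fun A => (measurableSet_iball_eq _ _ _).inter hS

/-- Given the ball of radius `R` around `u`, connections off the ball are not more likely than
unconditionally. -/
lemma measure_sphere_conn_off_le
    (hfin : ∀ (ω : G.edgeSet → Bool) r u, (iball ω r u).Finite)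
    (p : I) (R s : ℕ) (u v y : V) :
    prodBer G.edgeSet p {ω | ω ∈ conn G ∅ (R + 1) u v \ conn G ∅ R u v ∧
        ω ∈ conn G (iball ω R u) s v y} ≤
      prodBer G.edgeSet p (conn G ∅ (R + 1) u v \ conn G ∅ R u v) * cp G p s v y := by
  set μ := prodBer G.edgeSet p
  set S := conn G ∅ (R + 1) u v \ conn G ∅ R u v
  have hS : MeasurableSet S := (measurableSet_conn _ _ _ _).diff (measurableSet_conn _ _ _ _)
  have hsub : {ω | ω ∈ S ∧ ω ∈ conn G (iball ω R u) s v y} ⊆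
      ⋃ A : Finset V, ({ω | iball ω R u = A} ∩ S) ∩ conn G A s v y := by
    rintro ω ⟨h1, h2⟩
    simp only [Set.mem_iUnion]
    refine ⟨(hfin ω R u).toFinset, ⟨by simp, h1⟩, by simpa using h2⟩
  calc μ {ω | ω ∈ S ∧ ω ∈ conn G (iball ω R u) s v y}
      ≤ ∑' A : Finset V, μ (({ω | iball ω R u = A} ∩ S) ∩ conn G A s v y) :=
        (measure_mono hsub).trans (measure_iUnion_le _)
    _ = ∑' A : Finset V, μ ({ω | iball ω R u = A} ∩ S) * μ (conn G A s v y) := by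
        refine tsum_congr fun A => ?_
        refine prodBer_inter_of_dependsOn p (touch G A) ((measurableSet_iball_eq _ _ _).inter hS)
          (measurableSet_conn _ _ _ _) (dependsOn_iball _ R u ?_) (dependsOn_conn _ _ _ _)
        intro ω ω' h hω
        exact ⟨(h (R + 1) le_rfl v).1 hω.1, fun h' => hω.2 ((h R (by omega) v).2 h')⟩
    _ ≤ ∑' A : Finset V, μ ({ω | iball ω R u = A} ∩ S) * cp G p s v y :=
        ENNReal.tsum_le_tsum fun A => mul_le_mul' le_rfl
          (measure_mono (conn_subset_empty _ _ _ _))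
    _ = μ S * cp G p s v y := by
        rw [ENNReal.tsum_mul_right, ← measure_eq_tsum_iball hfin μ R u hS]

/-- Two connections are nearly independent of each other, and of the event that they
reach each other, up to a correction with four connections. -/
lemma cp_mul_cp_le (hfin : ∀ (ω : G.edgeSet → Bool) r u, (iball ω r u).Finite)
    (p : I) {r R : ℕ} (hrR : r ≤ R + 1) (s : ℕ) (u x v y : V) :
    cp G p r u x * cp G p s v y ≤
      prodBer G.edgeSet p ((conn G ∅ r u x ∩ conn G ∅ s v y) \ conn G ∅ R u y) +
        ∑' a, prodBer G.edgeSet p (conn G ∅ r u x ∩ conn G ∅ R u a) *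
          (cp G p s v a * cp G p s a y) := by
  classical
  set μ := prodBer G.edgeSet p
  have hC : MeasurableSet (conn G ∅ r u x) := measurableSet_conn _ _ _ _
  -- A connection that avoids the explored ball ends outside it; this is why `y` is unreachable from
  -- `u` within `R` in the main term.
  have hfirst : ∑' A : Finset V, μ ({ω | iball ω R u = A} ∩ conn G ∅ r u x) * μ (conn G A s v y)
      ≤ μ ((conn G ∅ r u x ∩ conn G ∅ s v y) \ conn G ∅ R u y) := by
    rw [measure_eq_tsum_iball hfin μ R u (((measurableSet_conn _ _ _ _).inter
      (measurableSet_conn _ _ _ _)).diff (measurableSet_conn _ _ _ _))]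
    refine ENNReal.tsum_le_tsum fun A => ?_
    rw [← prodBer_inter_of_dependsOn p (touch G A) ((measurableSet_iball_eq _ _ _).inter hC)
      (measurableSet_conn _ _ _ _) (dependsOn_iball _ R u fun ω ω' h hω => (h r hrR x).1 hω)
      (dependsOn_conn _ _ _ _)]
    refine measure_mono ?_
    rintro ω ⟨⟨h1, h2⟩, h3⟩
    refine ⟨h1, ⟨h2, conn_subset_empty _ _ _ _ h3⟩, fun h4 => conn_notMem_right h3 ?_⟩
    rw [← h1]; exact h4
  -- For connections that meet `A`, summing over the explored set turns `a ∈ A` back into the event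
  -- that `u` reaches `a` within `R`.
  have hsecond : ∑' A : Finset V, μ ({ω | iball ω R u = A} ∩ conn G ∅ r u x) *
        (∑' a, if a ∈ (A : Set V) then cp G p s v a * cp G p s a y else 0)
      = ∑' a, μ (conn G ∅ r u x ∩ conn G ∅ R u a) * (cp G p s v a * cp G p s a y) := by
    simp_rw [← ENNReal.tsum_mul_left]
    rw [ENNReal.tsum_comm]
    refine tsum_congr fun a => ?_
    rw [measure_eq_tsum_iball hfin μ R u (hC.inter (measurableSet_conn _ _ _ _)),
      ← ENNReal.tsum_mul_right]
    refine tsum_congr fun A => ?_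
    have hmem : ∀ ω : G.edgeSet → Bool, iball ω R u = A →
        (ω ∈ conn G ∅ R u a ↔ a ∈ (A : Set V)) := fun ω h => by rw [← h]; rfl
    split_ifs with ha
    · congr 2
      ext ω
      simp only [Set.mem_inter_iff, Set.mem_ofPred_eq]
      exact ⟨fun h => ⟨h.1, h.2, (hmem ω h.1).2 ha⟩, fun h => ⟨h.1, h.2.1⟩⟩
    · have : {ω : G.edgeSet → Bool | iball ω R u = A} ∩ (conn G ∅ r u x ∩ conn G ∅ R u a) = ∅ := by
        refine Set.eq_empty_of_forall_notMem fun ω h => ha ((hmem ω h.1).1 h.2.2)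
      rw [this]; simp
  calc cp G p r u x * cp G p s v y
      = ∑' A : Finset V, μ ({ω | iball ω R u = A} ∩ conn G ∅ r u x) * cp G p s v y := by
        rw [ENNReal.tsum_mul_right, ← measure_eq_tsum_iball hfin μ R u hC]; rfl
    _ ≤ ∑' A : Finset V, μ ({ω | iball ω R u = A} ∩ conn G ∅ r u x) *
          (μ (conn G A s v y) +
            ∑' a, if a ∈ (A : Set V) then cp G p s v a * cp G p s a y else 0) := by
        refine ENNReal.tsum_le_tsum fun A => mul_le_mul' le_rfl ?_
        refine le_trans ?_ (add_le_add le_rfl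
          (measure_conn_diff_le p (A : Set V) s v y))
        refine (measure_mono ?_).trans (measure_union_le _ _)
        rw [Set.union_sdiff_self]; exact Set.subset_union_right
    _ ≤ _ := by
        simp_rw [mul_add]
        rw [ENNReal.tsum_add, hsecond]
        exact add_le_add hfirst le_rfl

variable (G) in
/-- The expected size of the intrinsic sphere of radius `r + 1` around `u`. -/
def sph (p : I) (r : ℕ) (u : V) : ℝ≥0∞ :=
  ∑' y, prodBer G.edgeSet p (conn G ∅ (r + 1) u y \ conn G ∅ r u y)

lemma vol_succ (p : I) (r : ℕ) (u : V) : vol G p (r + 1) u = vol G p r u + sph G p r u := by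
  rw [vol, vol, sph, ← ENNReal.tsum_add]
  refine tsum_congr fun y => ?_
  rw [cp, cp, add_comm (prodBer G.edgeSet p _)]
  have h : conn G ∅ r u y ⊆ conn G ∅ (r + 1) u y := conn_mono_length (Nat.le_succ r) u y
  conv_lhs => rw [← Set.sdiff_union_of_subset h]
  exact measure_union Set.disjoint_sdiff_left (measurableSet_conn _ _ _ _)

/-- A vertex beyond the ball of radius `R` is reached off that ball from some point of the next
sphere, as in a branching process with mean offspring `sph G p R u`. -/
lemma vol_add_le (hfin : ∀ (ω : G.edgeSet → Bool) r u, (iball ω r u).Finite) {p : I}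
    (R s : ℕ) (u : V) (hinv : ∀ v, vol G p s v = vol G p s u) :
    vol G p (R + 1 + s) u ≤ vol G p R u + sph G p R u * vol G p s u := by
  set μ := prodBer G.edgeSet p
  have : ∀ y, cp G p (R + 1 + s) u y ≤ cp G p R u y +
      ∑' v, μ (conn G ∅ (R + 1) u v \ conn G ∅ R u v) * cp G p s v y := by
    intro y
    have hsub : conn G ∅ (R + 1 + s) u y ⊆ conn G ∅ R u y ∪
        ⋃ v, {ω | ω ∈ conn G ∅ (R + 1) u v \ conn G ∅ R u v ∧
          ω ∈ conn G (iball ω R u) s v y} := by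
      intro ω hω
      by_cases h' : ω ∈ conn G ∅ R u y
      · exact Or.inl h'
      · exact Or.inr (Set.mem_iUnion.2 (exists_sphere_conn_off hω h'))
    refine (measure_mono hsub).trans ((measure_union_le _ _).trans (add_le_add le_rfl ?_))
    refine (measure_iUnion_le _).trans (ENNReal.tsum_le_tsum fun v => ?_)
    exact measure_sphere_conn_off_le hfin p R s u v y
  refine (ENNReal.tsum_le_tsum this).trans ?_
  rw [ENNReal.tsum_add, ENNReal.tsum_comm]
  refine add_le_add le_rfl ?_
  simp_rw [ENNReal.tsum_mul_left]
  change ∑' v, μ (conn G ∅ (R + 1) u v \ conn G ∅ R u v) * vol G p s v ≤ _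
  simp_rw [hinv]
  rw [ENNReal.tsum_mul_right]; rfl

/-- If the expected cluster size is infinite, then all spheres have expected size at least one. -/
lemma one_le_sph (hfin : ∀ (ω : G.edgeSet → Bool) r u, (iball ω r u).Finite) {p : I} (u : V)
    (hinv : ∀ s v, vol G p s v = vol G p s u) (hlt : ∀ s, vol G p s u ≠ ∞)
    (hinf : ∀ M : ℝ≥0∞, M ≠ ∞ → ∃ k, M < vol G p k u) (R : ℕ) : 1 ≤ sph G p R u := by
  by_contra hcon
  push Not at hcon
  set g := sph G p R u
  have hg : 1 - g ≠ 0 := (tsub_pos_of_lt hcon).ne'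
  have hg1 : 1 - g ≠ ∞ := (tsub_le_self.trans_lt ENNReal.one_lt_top).ne
  -- `M` is the fixed point of `M ↦ vol G p R u + g * M`, which the induction therefore never
  -- exceeds.
  set M := vol G p R u / (1 - g) with hM
  have hMtop : M ≠ ∞ := ENNReal.div_ne_top (hlt R) hg
  have hMeq : vol G p R u + g * M = M := by
    have : vol G p R u = (1 - g) * M := by rw [hM, ENNReal.mul_div_cancel hg hg1]
    rw [this, ← add_mul, tsub_add_cancel_of_le hcon.le, one_mul]
  have hb : ∀ k, vol G p (k * (R + 1)) u ≤ M := by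
    intro k
    induction k with
    | zero =>
      rw [zero_mul]
      calc vol G p 0 u ≤ vol G p R u := vol_mono p (Nat.zero_le _) u
        _ ≤ vol G p R u + g * M := le_self_add
        _ = M := hMeq
    | succ k ih =>
      have : (k + 1) * (R + 1) = R + 1 + k * (R + 1) := by ring
      rw [this]
      calc _ ≤ vol G p R u + g * vol G p (k * (R + 1)) u := vol_add_le hfin R _ u (hinv _)
        _ ≤ vol G p R u + g * M := by gcongr
        _ = M := hMeq
  obtain ⟨k, hk⟩ := hinf M hMtop
  refine absurd hk (not_lt.2 ((vol_mono p ?_ u).trans (hb k)))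
  nlinarith

end Exploration

/-! ### Opening finitely many edges -/

section Surgery

variable {E : Type*}

open Classical in
/-- Open all the coordinates in a list. -/
def openList : List E → (E → Bool) → (E → Bool)
  | [], ω => ω
  | e :: l, ω => openList l (Function.update ω e true)

lemma measurable_openList (l : List E) : Measurable (openList l) := by
  classical
  induction l with
  | nil => exact measurable_id
  | cons e l ih => exact ih.comp (measurable_updateBool e true)

lemma le_openList (l : List E) (ω : E → Bool) (e : E) (h : ω e = true) :
    openList l ω e = true := by
  induction l generalizing ω with
  | nil => exact h
  | cons f l ih =>
    refine ih _ ?_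
    by_cases hf : e = f
    · subst hf; simp
    · simp [hf, h]

lemma openList_of_mem (l : List E) (ω : E → Bool) (e : E) (h : e ∈ l) :
    openList l ω e = true := by
  induction l generalizing ω with
  | nil => simp at h
  | cons f l ih =>
    rcases List.mem_cons.1 h with rfl | h
    · exact le_openList l _ _ (by simp)
    · exact ih _ h

open Classical in
/-- The event that `D` holds, but fails if `e` is closed. -/
def pivEvent (e : E) (D : Set (E → Bool)) : Set (E → Bool) :=
  {ω | ω ∈ D ∧ Function.update ω e false ∉ D}

lemma measurableSet_pivEvent (e : E) {D : Set (E → Bool)} (hD : MeasurableSet D) :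
    MeasurableSet (pivEvent e D) := by
  classical
  exact hD.inter (measurable_updateBool e false hD).compl

/-- If `D` can be achieved by opening a list of edges, then one of them becomes pivotal. -/
lemma op_pow_mul_le (p : I) {D : Set (E → Bool)} (hD : MeasurableSet D)
    (hmono : ∀ ω ω' : E → Bool, (∀ e, ω e = true → ω' e = true) → ω ∈ D → ω' ∈ D) (l : List E) :
    op p ^ l.length * prodBer E p {ω | ω ∉ D ∧ openList l ω ∈ D} ≤
      (l.map fun e => prodBer E p (pivEvent e D)).sum := by
  classical
  set μ := prodBer E p
  have hop : op p ≤ 1 := (op_add_cl p).symm ▸ le_self_add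
  induction l with
  | nil =>
    have : {ω : E → Bool | ω ∉ D ∧ openList [] ω ∈ D} = ∅ :=
      Set.eq_empty_of_forall_notMem fun ω h => h.1 h.2
    rw [this]; simp
  | cons e l ih =>
    set A₁ : Set (E → Bool) := {ω | Function.update ω e true ∈ pivEvent e D}
    set A₂ : Set (E → Bool) := {ω | Function.update ω e true ∈ {ω | ω ∉ D ∧ openList l ω ∈ D}}
    -- Open `e` first: either `D` now holds and `e` is pivotal, or the rest of the list still has to
    -- produce `D`.
    have hsub : {ω : E → Bool | ω ∉ D ∧ openList (e :: l) ω ∈ D} ⊆ A₁ ∪ A₂ := by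
      rintro ω ⟨h1, h2⟩
      by_cases h : Function.update ω e true ∈ D
      · refine Or.inl ⟨h, fun h3 => h1 (hmono _ _ ?_ h3)⟩
        intro f hf
        by_cases hfe : f = e
        · subst hfe; simp at hf
        · simpa [hfe] using hf
      · exact Or.inr ⟨h, h2⟩
    have h1 : op p * μ A₁ ≤ μ (pivEvent e D) :=
      op_mul_prodBer_update_le p e (measurableSet_pivEvent e hD)
    have h2 : op p * μ A₂ ≤ μ {ω | ω ∉ D ∧ openList l ω ∈ D} :=
      op_mul_prodBer_update_le p e (hD.compl.inter (measurable_openList l hD))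
    have hpow : op p ^ l.length ≤ 1 := pow_le_one₀ (zero_le) hop
    rw [List.map_cons, List.sum_cons, List.length_cons, pow_succ]
    calc op p ^ l.length * op p * μ {ω | ω ∉ D ∧ openList (e :: l) ω ∈ D}
        ≤ op p ^ l.length * op p * (μ A₁ + μ A₂) := by
          gcongr; exact (measure_mono hsub).trans (measure_union_le _ _)
      _ = op p ^ l.length * (op p * μ A₁) + op p ^ l.length * (op p * μ A₂) := by ring
      _ ≤ 1 * μ (pivEvent e D) + op p ^ l.length * μ {ω | ω ∉ D ∧ openList l ω ∈ D} := by
          gcongr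
      _ ≤ _ := by rw [one_mul]; gcongr

variable {V : Type*} {G : SimpleGraph V} [Countable V]

/-- Along a short path there are few pivotal edges. -/
lemma tsum_pivEvent_le (p : I) (R : ℕ) (u y : V) {W : Type*} [Countable W] (e : W → G.edgeSet)
    (φ : W → V) (hφ : Function.Injective φ) (he : ∀ x, φ x ∈ (e x : Sym2 V)) :
    ∑' x, prodBer G.edgeSet p (pivEvent (e x) (conn G ∅ R u y)) ≤ (R + 1) * cp G p R u y := by
  classical
  set D := conn G ∅ R u y
  have hD : MeasurableSet D := measurableSet_conn _ _ _ _
  have hmeas : ∀ x, MeasurableSet (pivEvent (e x) D) := fun x => measurableSet_pivEvent _ hD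
  simp_rw [← lintegral_indicator_one (hmeas _)]
  rw [← lintegral_tsum fun x => (measurable_one.indicator (hmeas x)).aemeasurable, cp,
    ← lintegral_indicator_one hD, ← lintegral_const_mul _ (measurable_one.indicator hD)]
  refine lintegral_mono fun ω => ?_
  by_cases hω : ω ∈ D
  · obtain ⟨γ, hγ, -, ho⟩ := hω
    -- Closing an edge off `γ` leaves `γ` open, so every pivotal edge lies on `γ`. Counting the
    -- vertices `φ x` avoids asking that `e` be injective.
    have hmem : ∀ x, ω ∈ pivEvent (e x) D → φ x ∈ γ.support.toFinset := by
      intro x hx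
      have hx' : (e x : Sym2 V) ∈ γ.edges := by
        by_contra hcon
        refine hx.2 ⟨γ, hγ, by simp, fun f hf => ?_⟩
        have : f ≠ e x := by rintro rfl; exact hcon hf
        simpa [this] using ho f hf
      exact List.mem_toFinset.2 (γ.mem_support_of_mem_edges hx' (he x))
    calc ∑' x, (pivEvent (e x) D).indicator 1 ω
        ≤ ∑' x, (fun z => if z ∈ γ.support.toFinset then (1 : ℝ≥0∞) else 0) (φ x) := by
          refine ENNReal.tsum_le_tsum fun x => ?_
          by_cases hx : ω ∈ pivEvent (e x) D
          · simp only [hmem x hx, if_true]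
            exact Set.indicator_le_self' (fun _ _ => by simp) _
          · rw [Set.indicator_of_notMem hx]; exact zero_le
      _ ≤ ∑' z, if z ∈ γ.support.toFinset then (1 : ℝ≥0∞) else 0 :=
          ENNReal.tsum_comp_le_tsum_of_injective hφ _
      _ = γ.support.toFinset.card := by
          rw [tsum_eq_sum (s := γ.support.toFinset) (fun z hz => by simp [hz])]
          rw [Finset.sum_congr rfl fun z hz => if_pos hz]; simp
      _ ≤ R + 1 := by
          have h1 := γ.support.toFinset_card_le
          rw [γ.length_support] at h1
          exact_mod_cast h1.trans (by omega)
      _ = _ := by 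
          rw [Set.indicator_of_mem (show ω ∈ D from ⟨γ, hγ, by simp, ho⟩)]; simp
  · have : ∀ x, (pivEvent (e x) D).indicator (1 : (G.edgeSet → Bool) → ℝ≥0∞) ω = 0 := fun x =>
      Set.indicator_of_notMem (fun h => hω h.1) _
    simp [this]

end Surgery

/-! ### Transitive graphs on groups -/

section Translation

variable {V : Type*} {G : SimpleGraph V} [AddCommGroup V]

/-- The translate of an edge. -/
def shiftEdge (htr : ∀ a x y : V, G.Adj (x + a) (y + a) ↔ G.Adj x y) (a : V) (e : G.edgeSet) :
    G.edgeSet :=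
  ⟨Sym2.map (· + a) e.1, by
    obtain ⟨e, he⟩ := e
    induction e with | _ x y
    exact (htr a x y).2 he⟩

/-- Translation as an equivalence of the edge set. -/
def shiftEquiv (htr : ∀ a x y : V, G.Adj (x + a) (y + a) ↔ G.Adj x y) (a : V) :
    G.edgeSet ≃ G.edgeSet where
  toFun := shiftEdge htr a
  invFun := shiftEdge htr (-a)
  left_inv e := by
    obtain ⟨e, he⟩ := e
    induction e with | _ x y
    simp [shiftEdge]
  right_inv e := by
    obtain ⟨e, he⟩ := e
    induction e with | _ x y
    simp [shiftEdge]

/-- Translation as a graph homomorphism. -/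
def shiftHom (htr : ∀ a x y : V, G.Adj (x + a) (y + a) ↔ G.Adj x y) (a : V) : G →g G where
  toFun x := x + a
  map_rel' h := (htr a _ _).2 h

lemma exists_shift_walk (htr : ∀ a x y : V, G.Adj (x + a) (y + a) ↔ G.Adj x y) (a : V) {x y : V}
    (p : G.Walk x y) : ∃ q : G.Walk (x + a) (y + a), q.length = p.length ∧
      ∀ e ∈ q.edges, ∃ f ∈ p.edges, Sym2.map (· + a) f = e := by
  have h1 := SimpleGraph.Walk.length_map (shiftHom htr a) p
  have h2 : ∀ e ∈ (p.map (shiftHom htr a)).edges, ∃ f ∈ p.edges, Sym2.map (· + a) f = e := by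
    intro e he
    rw [SimpleGraph.Walk.edges_map, List.mem_map] at he
    exact he
  exact ⟨p.map (shiftHom htr a), h1, h2⟩

lemma map_reindex {E : Type*} (p : I) (f : E ≃ E) :
    (prodBer E p).map (fun ω => ω ∘ f) = prodBer E p := by
  unfold prodBer
  have h := Measure.infinitePi_map_piCongrLeft
    (μ := fun _ : E => bernoulliMeasure true false p) f.symm
  convert h using 2
  funext ω e
  have := Equiv.piCongrLeft_apply_apply (P := fun _ : E => Bool) f.symm ω (f e)
  rw [Equiv.symm_apply_apply] at this
  exact this.symm

lemma conn_shift (htr : ∀ a x y : V, G.Adj (x + a) (y + a) ↔ G.Adj x y) (a : V) {r : ℕ}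
    {x y : V} {ω : G.edgeSet → Bool} (h : ω ∘ shiftEquiv htr a ∈ conn G ∅ r x y) :
    ω ∈ conn G ∅ r (x + a) (y + a) := by
  obtain ⟨p, hp, -, ho⟩ := h
  obtain ⟨q, hq, hqe⟩ := exists_shift_walk htr a p
  refine ⟨q, hq.trans_le hp, by simp, fun e he => ?_⟩
  obtain ⟨f, hf, hfe⟩ := hqe _ he
  have := ho ⟨f, p.edges_subset_edgeSet hf⟩ hf
  have heq : e = shiftEquiv htr a ⟨f, p.edges_subset_edgeSet hf⟩ := Subtype.ext hfe.symm
  rw [heq]; exact this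

variable [Countable V]

lemma cp_shift (htr : ∀ a x y : V, G.Adj (x + a) (y + a) ↔ G.Adj x y) (p : I) (r : ℕ) (a x y : V) :
    cp G p r (x + a) (y + a) = cp G p r x y := by
  have key : ∀ a x y : V, cp G p r x y ≤ cp G p r (x + a) (y + a) := by
    intro a x y
    rw [cp, cp]
    conv_lhs => rw [← map_reindex p (shiftEquiv htr a)]
    rw [Measure.map_apply (by fun_prop) (measurableSet_conn _ _ _ _)]
    exact measure_mono fun ω hω => conn_shift htr a hω
  refine le_antisymm ?_ (key a x y)
  simpa using key (-a) (x + a) (y + a)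

lemma vol_shift (htr : ∀ a x y : V, G.Adj (x + a) (y + a) ↔ G.Adj x y) (p : I) (r : ℕ) (x : V) :
    vol G p r x = vol G p r 0 := by
  have h : ∀ y, cp G p r x y = cp G p r 0 (y - x) := fun y => by
    have := cp_shift htr p r x 0 (y - x)
    simpa using this
  rw [vol, vol, ← (Equiv.subRight x).tsum_eq (fun y => cp G p r 0 y)]
  exact tsum_congr h

/-- The translate of an oriented edge, as an edge. -/
def shiftDart (htr : ∀ a x y : V, G.Adj (x + a) (y + a) ↔ G.Adj x y) (a : V) (d : G.Dart) :
    G.edgeSet :=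
  shiftEdge htr a ⟨d.edge, d.edge_mem⟩

/-- Opening the translate of `q` by `x` joins both connections into one from `0` to `y`. At the cost
`op p ^ q.length` one of its edges becomes pivotal, and for each dart of `q` the sum over its
translates counts pivotal edges along a short path. -/
lemma tsum_measure_bridge_le (htr : ∀ a x y : V, G.Adj (x + a) (y + a) ↔ G.Adj x y) (p : I)
    {w : V} (q : G.Walk 0 w) (r : ℕ) :
    op p ^ q.length * ∑' y, ∑' x, prodBer G.edgeSet p
        ((conn G ∅ r 0 x ∩ conn G ∅ r (w + x) y) \ conn G ∅ (r + q.length + r) 0 y) ≤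
      q.length * ((r + q.length + r : ℕ) + 1) * vol G p (r + q.length + r) 0 := by
  set R := r + q.length + r with hR
  set μ := prodBer G.edgeSet p
  have h1 : ∀ x y, op p ^ q.length *
      μ ((conn G ∅ r 0 x ∩ conn G ∅ r (w + x) y) \ conn G ∅ R 0 y) ≤
      (q.darts.map fun d => μ (pivEvent (shiftDart htr x d) (conn G ∅ R 0 y))).sum := by
    intro x y
    have h := op_pow_mul_le p (measurableSet_conn (G := G) ∅ R 0 y)
      (fun ω ω' hω h => conn_mono_config hω h) (q.darts.map (shiftDart htr x))
    rw [List.length_map, q.length_darts, List.map_map] at h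
    refine le_trans ?_ h
    gcongr
    rintro ω ⟨⟨h1, h2⟩, h3⟩
    refine ⟨h3, ?_⟩
    set ω' := openList (q.darts.map (shiftDart htr x)) ω
    have hle : ∀ e, ω e = true → ω' e = true := fun e he => le_openList _ ω e he
    have hmid : ω' ∈ conn G ∅ q.length x (w + x) := by
      have : ω' ∈ conn G ∅ q.length (0 + x) (w + x) := by
        obtain ⟨q', hq', hqe⟩ := exists_shift_walk htr x q
        refine ⟨q', hq'.le, by simp, fun e he => ?_⟩
        obtain ⟨f, hf, hfe⟩ := hqe _ he
        obtain ⟨d, hd, rfl⟩ := List.mem_map.1 hf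
        refine openList_of_mem _ _ _ (List.mem_map.2 ⟨d, hd, Subtype.ext hfe⟩)
      rwa [zero_add] at this
    exact conn_trans (conn_trans (conn_mono_config hle h1) hmid) (conn_mono_config hle h2)
  calc op p ^ q.length * ∑' y, ∑' x, μ ((conn G ∅ r 0 x ∩ conn G ∅ r (w + x) y) \ conn G ∅ R 0 y)
      = ∑' y, ∑' x, op p ^ q.length *
          μ ((conn G ∅ r 0 x ∩ conn G ∅ r (w + x) y) \ conn G ∅ R 0 y) := by
        simp_rw [ENNReal.tsum_mul_left]
    _ ≤ ∑' y, ∑' x, (q.darts.map fun d =>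
          μ (pivEvent (shiftDart htr x d) (conn G ∅ R 0 y))).sum :=
        ENNReal.tsum_le_tsum fun y => ENNReal.tsum_le_tsum fun x => h1 x y
    _ ≤ ∑' y, q.length * ((R + 1) * cp G p R 0 y) := by
        refine ENNReal.tsum_le_tsum fun y => ?_
        have : ∀ l : List G.Dart, ∑' x, (l.map fun d =>
            μ (pivEvent (shiftDart htr x d) (conn G ∅ R 0 y))).sum ≤
            l.length * ((R + 1) * cp G p R 0 y) := by
          intro l
          induction l with
          | nil => simp
          | cons d l ih =>
            simp only [List.map_cons, List.sum_cons, List.length_cons]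
            rw [ENNReal.tsum_add, Nat.cast_add, Nat.cast_one, add_mul, one_mul, add_comm]
            refine add_le_add ih ?_
            refine tsum_pivEvent_le p R 0 y (fun x => shiftDart htr x d) (fun x => d.fst + x)
              (add_right_injective _) fun x => ?_
            simp only [shiftDart, shiftEdge, Sym2.mem_map]
            exact ⟨d.fst, by simp [SimpleGraph.Dart.edge], rfl⟩
        simpa using this q.darts
    _ = _ := by
        rw [ENNReal.tsum_mul_left, ENNReal.tsum_mul_left, ← mul_assoc]; rfl

/-- Under a small open triangle, the expected volume of balls is nearly supermultiplicative. -/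
lemma vol_sq_le (htr : ∀ a x y : V, G.Adj (x + a) (y + a) ↔ G.Adj x y)
    (hfin : ∀ (ω : G.edgeSet → Bool) r u, (iball ω r u).Finite) (p : I)
    {w : V} (q : G.Walk 0 w) (r : ℕ) (hvol : vol G p r 0 ≠ ∞)
    (htri : ∀ z, ∑' x, ∑' a, cp G p r z x * (cp G p (r + q.length + r) z a * cp G p r (w + x) a)
      ≤ 2⁻¹) :
    op p ^ q.length * vol G p r 0 ^ 2 ≤
      2 * (q.length * ((r + q.length + r : ℕ) + 1) * vol G p (r + q.length + r) 0) := by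
  set R := r + q.length + r with hR
  set μ := prodBer G.edgeSet p
  set v := vol G p r 0 with hv
  set X := ∑' y, ∑' x, μ ((conn G ∅ r 0 x ∩ conn G ∅ r (w + x) y) \ conn G ∅ R 0 y) with hX
  have hmain : v ^ 2 ≤ X + v ^ 2 * 2⁻¹ := by
    have hlhs : v ^ 2 = ∑' y, ∑' x, cp G p r 0 x * cp G p r (w + x) y := by
      rw [ENNReal.tsum_comm]
      simp_rw [ENNReal.tsum_mul_left]
      change _ = ∑' x, cp G p r 0 x * vol G p r (w + x)
      simp_rw [vol_shift htr p r (_ + _)]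
      rw [ENNReal.tsum_mul_right, sq]; rfl
    calc v ^ 2 = ∑' y, ∑' x, cp G p r 0 x * cp G p r (w + x) y := hlhs
      _ ≤ ∑' y, ∑' x, (μ ((conn G ∅ r 0 x ∩ conn G ∅ r (w + x) y) \ conn G ∅ R 0 y) +
            ∑' a, μ (conn G ∅ r 0 x ∩ conn G ∅ R 0 a) * (cp G p r (w + x) a * cp G p r a y)) :=
          ENNReal.tsum_le_tsum fun y => ENNReal.tsum_le_tsum fun x =>
            cp_mul_cp_le hfin p (by omega) r 0 x (w + x) y
      _ = X + ∑' y, ∑' x, ∑' a, μ (conn G ∅ r 0 x ∩ conn G ∅ R 0 a) *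
            (cp G p r (w + x) a * cp G p r a y) := by
          simp_rw [ENNReal.tsum_add]; rfl
      _ ≤ X + v ^ 2 * 2⁻¹ := by
          gcongr
          calc ∑' y, ∑' x, ∑' a, μ (conn G ∅ r 0 x ∩ conn G ∅ R 0 a) *
                (cp G p r (w + x) a * cp G p r a y)
              = ∑' x, ∑' a, ∑' y, μ (conn G ∅ r 0 x ∩ conn G ∅ R 0 a) *
                (cp G p r (w + x) a * cp G p r a y) := by
                rw [ENNReal.tsum_comm]
                exact tsum_congr fun x => ENNReal.tsum_comm
            _ = ∑' x, ∑' a, μ (conn G ∅ r 0 x ∩ conn G ∅ R 0 a) * cp G p r (w + x) a * v := by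
                refine tsum_congr fun x => tsum_congr fun a => ?_
                simp_rw [← mul_assoc]
                rw [ENNReal.tsum_mul_left]
                congr 1
                exact vol_shift htr p r a
            _ ≤ ∑' x, ∑' a, (∑' z, cp G p r 0 z * (cp G p r z x * cp G p R z a)) *
                  cp G p r (w + x) a * v := by
                refine ENNReal.tsum_le_tsum fun x => ENNReal.tsum_le_tsum fun a => ?_
                gcongr
                exact measure_conn_inter_le p r R 0 x a
            -- Regrouping around the branch point `z` of the tripod isolates the open triangle
            -- bounded by `htri`.
            _ = (∑' z, cp G p r 0 z * ∑' x, ∑' a, cp G p r z x *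
                  (cp G p R z a * cp G p r (w + x) a)) * v := by
                simp_rw [ENNReal.tsum_mul_right]
                congr 1
                simp_rw [← ENNReal.tsum_mul_left, ← ENNReal.tsum_mul_right]
                rw [ENNReal.tsum_comm (f := fun z x => ∑' a, cp G p r 0 z *
                  (cp G p r z x * (cp G p R z a * cp G p r (w + x) a)))]
                refine tsum_congr fun x => ?_
                rw [ENNReal.tsum_comm]
                refine tsum_congr fun z => tsum_congr fun a => ?_
                ring
            _ ≤ (∑' z, cp G p r 0 z * 2⁻¹) * v := by
                gcongr with z
                exact htri z
            _ = v ^ 2 * 2⁻¹ := by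
                rw [ENNReal.tsum_mul_right]
                change v * 2⁻¹ * v = _
                ring
  have hhalf : v ^ 2 * 2⁻¹ ≤ X := by
    -- Finiteness of `v` is what allows the error, half of `v ^ 2`, to be absorbed on the left.
    have hne : v ^ 2 * 2⁻¹ ≠ ∞ := ENNReal.mul_ne_top (ENNReal.pow_ne_top hvol) (by simp)
    have hsplit : v ^ 2 = v ^ 2 * 2⁻¹ + v ^ 2 * 2⁻¹ := by
      rw [← mul_add, ENNReal.inv_two_add_inv_two, mul_one]
    exact (ENNReal.add_le_add_iff_right hne).1 (hsplit ▸ hmain)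
  have hv2 : v ^ 2 ≤ 2 * X := by
    calc v ^ 2 = 2 * (v ^ 2 * 2⁻¹) := by
          rw [mul_comm, mul_assoc, ENNReal.inv_mul_cancel (by simp) (by simp), mul_one]
      _ ≤ 2 * X := by gcongr
  calc op p ^ q.length * v ^ 2 ≤ op p ^ q.length * (2 * X) := by gcongr
    _ = 2 * (op p ^ q.length * X) := by ring
    _ ≤ _ := mul_le_mul' le_rfl (tsum_measure_bridge_le htr p q r)

end Translation

/-! ### The open triangle -/

section Triangle

lemma mul_mul_le_cubes (u v w : ℝ≥0∞) : u * v * w ≤ u ^ 3 + v ^ 3 + w ^ 3 := by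
  have key : ∀ m : ℝ≥0∞, u ≤ m → v ≤ m → w ≤ m → u * v * w ≤ m ^ 3 := fun m hu hv hw => by
    calc u * v * w ≤ m * m * m := by gcongr
      _ = m ^ 3 := by ring
  rcases le_total u v with h | h
  · rcases le_total v w with h' | h'
    · exact (key w (h.trans h') h' le_rfl).trans le_add_self
    · exact (key v h le_rfl h').trans (le_add_self.trans le_self_add)
  · rcases le_total u w with h' | h'
    · exact (key w h' (h.trans h') le_rfl).trans le_add_self
    · exact (key u le_rfl h h').trans (le_self_add.trans le_self_add)

variable {V : Type*} [AddCommGroup V]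

/-- A form of Young's convolution inequality with three exponents `3/2`. -/
lemma tsum_triangle_le (f g h : V → ℝ≥0∞) (w : V) {α β γ : ℝ≥0∞} (h1 : α * β * γ = 1) :
    ∑' x, ∑' a, f x ^ 2 * (g a ^ 2 * h (a - x - w) ^ 2) ≤
      α ^ 3 * ((∑' x, f x ^ 3) * ∑' x, g x ^ 3) + β ^ 3 * ((∑' x, g x ^ 3) * ∑' x, h x ^ 3) +
        γ ^ 3 * ((∑' x, f x ^ 3) * ∑' x, h x ^ 3) := by
  have hpt : ∀ x a, f x ^ 2 * (g a ^ 2 * h (a - x - w) ^ 2) ≤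
      α ^ 3 * (f x ^ 3 * g a ^ 3) + β ^ 3 * (g a ^ 3 * h (a - x - w) ^ 3) +
        γ ^ 3 * (f x ^ 3 * h (a - x - w) ^ 3) := by
    intro x a
    set b := h (a - x - w)
    -- Group the six factors into the three pairs. Once cubed, each pair sums over `x` and `a` to a
    -- product of two sums of cubes.
    calc f x ^ 2 * (g a ^ 2 * b ^ 2)
        = (α * β * γ) * (f x ^ 2 * (g a ^ 2 * b ^ 2)) := by rw [h1, one_mul]
      _ = (α * (f x * g a)) * (β * (g a * b)) * (γ * (f x * b)) := by ring
      _ ≤ _ := mul_mul_le_cubes _ _ _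
      _ = _ := by ring
  have e1 : ∑' x, ∑' a, α ^ 3 * (f x ^ 3 * g a ^ 3) =
      α ^ 3 * ((∑' x, f x ^ 3) * ∑' x, g x ^ 3) := by
    simp_rw [ENNReal.tsum_mul_left, ENNReal.tsum_mul_right]
  have e2 : ∑' x, ∑' a, β ^ 3 * (g a ^ 3 * h (a - x - w) ^ 3) =
      β ^ 3 * ((∑' x, g x ^ 3) * ∑' x, h x ^ 3) := by
    rw [ENNReal.tsum_comm]
    simp_rw [ENNReal.tsum_mul_left]
    have : ∀ a, ∑' x, h (a - x - w) ^ 3 = ∑' x, h x ^ 3 := fun a =>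
      ((Equiv.subLeft a).trans (Equiv.subRight w)).tsum_eq (fun x => h x ^ 3)
    simp_rw [this, ENNReal.tsum_mul_right]
  have e3 : ∑' x, ∑' a, γ ^ 3 * (f x ^ 3 * h (a - x - w) ^ 3) =
      γ ^ 3 * ((∑' x, f x ^ 3) * ∑' x, h x ^ 3) := by
    simp_rw [ENNReal.tsum_mul_left]
    have : ∀ x, ∑' a, h (a - x - w) ^ 3 = ∑' x, h x ^ 3 := fun x =>
      ((Equiv.subRight x).trans (Equiv.subRight w)).tsum_eq (fun a => h a ^ 3)
    simp_rw [this, ENNReal.tsum_mul_right]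
  calc _ ≤ ∑' x, ∑' a, (α ^ 3 * (f x ^ 3 * g a ^ 3) + β ^ 3 * (g a ^ 3 * h (a - x - w) ^ 3) +
        γ ^ 3 * (f x ^ 3 * h (a - x - w) ^ 3)) :=
        ENNReal.tsum_le_tsum fun x => ENNReal.tsum_le_tsum fun a => hpt x a
    _ = _ := by
      simp_rw [ENNReal.tsum_add]
      rw [e1, e2, e3]

/-- The open triangle can be made arbitrarily small. -/
lemma exists_triangle_le [Infinite V] (f : V → ℝ≥0∞) (hf : ∑' x, f x ^ 3 ≠ ∞) {η : ℝ≥0∞}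
    (hη : η ≠ 0) : ∃ w, ∑' x, ∑' a, f x ^ 2 * (f a ^ 2 * f (a - x - w) ^ 2) ≤ η := by
  classical
  set S := ∑' x, f x ^ 3 with hS
  have hS2 : S * S ≠ ∞ := ENNReal.mul_ne_top hf hf
  have hη6 : η / 6 ≠ 0 := (ENNReal.div_pos hη (by simp)).ne'
  obtain ⟨n, hn0, hn⟩ := ENNReal.exists_nnreal_pos_mul_lt hS2 hη6
  -- Below, the weight `t` multiplies the one product free of the tail, while the large weight `t⁻¹`
  -- always multiplies a product containing the tail sum, which is made small afterwards.
  set t : NNReal := min n 1 with ht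
  have ht0 : (t : ℝ≥0∞) ≠ 0 := by
    have : 0 < t := lt_min hn0 one_pos
    exact_mod_cast this.ne'
  have ht1 : (t : ℝ≥0∞) ≤ 1 := by exact_mod_cast min_le_right n 1
  have htn : (t : ℝ≥0∞) ≤ n := by exact_mod_cast min_le_left n 1
  have ht3 : (t : ℝ≥0∞) ^ 3 * (S * S) ≤ η / 6 := by
    calc (t : ℝ≥0∞) ^ 3 * (S * S) ≤ t ^ 1 * (S * S) := by
          gcongr ?_ * _
          exact pow_le_pow_of_le_one zero_le ht1 (by norm_num)
      _ ≤ n * (S * S) := by rw [pow_one]; gcongr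
      _ ≤ _ := hn.le
  have htt : (t : ℝ≥0∞) * 1 * (t : ℝ≥0∞)⁻¹ = 1 := by
    rw [mul_one, ENNReal.mul_inv_cancel ht0 ENNReal.coe_ne_top]
  set K : ℝ≥0∞ := ((t : ℝ≥0∞)⁻¹ ^ 3 + 1) * S with hK
  have hKtop : K ≠ ∞ := ENNReal.mul_ne_top
    (ENNReal.add_ne_top.2 ⟨ENNReal.pow_ne_top (ENNReal.inv_ne_top.2 ht0), by simp⟩) hf
  obtain ⟨m, hm0, hm⟩ := ENNReal.exists_nnreal_pos_mul_lt hKtop hη6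
  have htail := ENNReal.tendsto_tsum_compl_atTop_zero hf
  have hm0' : (0 : ℝ≥0∞) < m := by exact_mod_cast hm0
  obtain ⟨F, hF⟩ := ((tendsto_order.1 htail).2 m hm0').exists
  set g : V → ℝ≥0∞ := fun x => if x ∈ F then 0 else f x with hg
  have hgS : ∑' x, g x ^ 3 ≤ m := by
    refine le_trans (le_of_eq ?_) hF.le
    have : ∑' b : { x // x ∉ F }, f b ^ 3 = ∑' b : ({x | x ∉ F} : Set V), f b ^ 3 := rfl
    rw [this, tsum_subtype {x | x ∉ F} (fun x => f x ^ 3)]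
    refine tsum_congr fun x => ?_
    by_cases hx : x ∈ F <;> simp [hg, hx]
  have hKm : K * ∑' x, g x ^ 3 ≤ η / 6 :=
    calc K * ∑' x, g x ^ 3 ≤ K * m := by gcongr
      _ = m * K := mul_comm _ _
      _ ≤ _ := hm.le
  -- For `w` outside `F - F - F`, the points `x`, `a`, `a - x - w` never all lie in `F`, so one of
  -- the factors may be replaced by its tail `g`.
  obtain ⟨w, hw⟩ := Infinite.exists_notMem_finset
    (((F ×ˢ F) ×ˢ F).image fun q => q.1.1 - q.1.2 - q.2)
  refine ⟨w, ?_⟩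
  have hpt : ∀ x a, f x ^ 2 * (f a ^ 2 * f (a - x - w) ^ 2) ≤
      g x ^ 2 * (f a ^ 2 * f (a - x - w) ^ 2) + f x ^ 2 * (g a ^ 2 * f (a - x - w) ^ 2) +
        f x ^ 2 * (f a ^ 2 * g (a - x - w) ^ 2) := by
    intro x a
    by_cases hx : x ∈ F
    · by_cases ha : a ∈ F
      · have hb : a - x - w ∉ F := by
          intro hb
          refine hw (Finset.mem_image.2 ⟨((a, x), a - x - w), ?_, by simp⟩)
          simp [hx, ha, hb]
        have : g (a - x - w) = f (a - x - w) := if_neg hb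
        rw [this]; exact le_add_self
      · have : g a = f a := if_neg ha
        rw [this]; exact le_add_self.trans le_self_add
    · have : g x = f x := if_neg hx
      rw [this]; exact le_self_add.trans le_self_add
  set s := ∑' x, g x ^ 3
  have b1 : ∑' x, ∑' a, g x ^ 2 * (f a ^ 2 * f (a - x - w) ^ 2) ≤ η / 6 + η / 6 := by
    refine (tsum_triangle_le g f f w (α := 1) (β := t) (γ := (t : ℝ≥0∞)⁻¹)
      (by rw [one_mul, ENNReal.mul_inv_cancel ht0 ENNReal.coe_ne_top])).trans ?_
    calc _ = t ^ 3 * (S * S) + K * s := by rw [hK]; ring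
      _ ≤ _ := add_le_add ht3 hKm
  have b2 : ∑' x, ∑' a, f x ^ 2 * (g a ^ 2 * f (a - x - w) ^ 2) ≤ η / 6 + η / 6 := by
    refine (tsum_triangle_le f g f w (α := 1) (β := (t : ℝ≥0∞)⁻¹) (γ := t)
      (by rw [one_mul, ENNReal.inv_mul_cancel ht0 ENNReal.coe_ne_top])).trans ?_
    calc _ = t ^ 3 * (S * S) + K * s := by rw [hK]; ring
      _ ≤ _ := add_le_add ht3 hKm
  have b3 : ∑' x, ∑' a, f x ^ 2 * (f a ^ 2 * g (a - x - w) ^ 2) ≤ η / 6 + η / 6 := by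
    refine (tsum_triangle_le f f g w (α := t) (β := 1) (γ := (t : ℝ≥0∞)⁻¹) htt).trans ?_
    calc _ = t ^ 3 * (S * S) + K * s := by rw [hK]; ring
      _ ≤ _ := add_le_add ht3 hKm
  calc _ ≤ ∑' x, ∑' a, (g x ^ 2 * (f a ^ 2 * f (a - x - w) ^ 2) +
        f x ^ 2 * (g a ^ 2 * f (a - x - w) ^ 2) + f x ^ 2 * (f a ^ 2 * g (a - x - w) ^ 2)) :=
        ENNReal.tsum_le_tsum fun x => ENNReal.tsum_le_tsum fun a => hpt x a
    _ ≤ (η / 6 + η / 6) + (η / 6 + η / 6) + (η / 6 + η / 6) := by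
        simp_rw [ENNReal.tsum_add]
        exact add_le_add (add_le_add b1 b2) b3
    _ = 6 * (η / 6) := by ring
    _ = η := ENNReal.mul_div_cancel (by simp) (by simp)

end Triangle

/-! ### Sums of powers of the Euclidean norm -/

section PowNorm

variable {d : ℕ}

lemma abs_le_euclNorm (x : Fin d → ℤ) (i : Fin d) : |(x i : ℝ)| ≤ euclNorm x := by
  have := PiLp.norm_apply_le (WithLp.toLp 2 (fun i => (x i : ℝ)) : EuclideanSpace ℝ (Fin d)) i
  simpa [euclNorm] using this

lemma euclNorm_nonneg (x : Fin d → ℤ) : 0 ≤ euclNorm x := norm_nonneg _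

lemma one_le_euclNorm {x : Fin d → ℤ} (hx : x ≠ 0) : 1 ≤ euclNorm x := by
  obtain ⟨i, hi⟩ := Function.ne_iff.1 hx
  refine le_trans ?_ (abs_le_euclNorm x i)
  exact_mod_cast Int.one_le_abs hi

lemma euclNorm_le {x : Fin d → ℤ} {n : ℕ} (h : ∀ i, |x i| ≤ n) : euclNorm x ≤ d * n := by
  have h2 : euclNorm x ^ 2 ≤ (d * n : ℝ) ^ 2 := by
    rw [euclNorm, EuclideanSpace.norm_sq_eq]
    calc ∑ i, ‖(x i : ℝ)‖ ^ 2 ≤ ∑ _i : Fin d, (n : ℝ) ^ 2 := by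
          refine Finset.sum_le_sum fun i _ => ?_
          have : |(x i : ℝ)| ≤ n := by exact_mod_cast h i
          rw [Real.norm_eq_abs]; gcongr
      _ = d * (n : ℝ) ^ 2 := by simp
      _ ≤ (d * n : ℝ) ^ 2 := by
          rw [mul_pow]
          gcongr
          exact_mod_cast Nat.le_self_pow (by norm_num) d
  exact (abs_le_of_sq_le_sq' h2 (by positivity)).2

lemma powNorm_pos (x : Fin d → ℤ) : 0 < powNorm x := by
  unfold powNorm
  split_ifs with h
  · exact one_pos
  · exact zpow_pos (one_pos.trans_le (one_le_euclNorm h)) _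

lemma powNorm_ge (hd : 6 < d) {x : Fin d → ℤ} {n : ℕ} (hn : 1 ≤ n) (h : ∀ i, |x i| ≤ n) :
    ((d * n : ℝ) ^ (d - 2))⁻¹ ≤ powNorm x := by
  have hd1 : (1 : ℝ) ≤ d := by exact_mod_cast (by omega : 1 ≤ d)
  have hn1 : (1 : ℝ) ≤ n := by exact_mod_cast hn
  have h1 : (1 : ℝ) ≤ d * n := by nlinarith
  unfold powNorm
  split_ifs with hx
  · exact inv_le_one_of_one_le₀ (one_le_pow₀ h1)
  · have : (2 - (d : ℤ)) = -((d - 2 : ℕ) : ℤ) := by omega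
    rw [this, zpow_neg, zpow_natCast]
    have := one_le_euclNorm hx
    gcongr
    exact euclNorm_le h

/-- A box of radius `n` has at least `n ^ d` points, each contributing at least order `n ^ (2 - d)`,
for a total of order at least `n ^ 2`. -/
lemma tsum_powNorm_eq_top (hd : 6 < d) : ∑' x : Fin d → ℤ, ENNReal.ofReal (powNorm x) = ∞ := by
  refine ENNReal.eq_top_of_forall_nnreal_le fun M => ?_
  have hd1 : (1 : ℝ) ≤ d := by exact_mod_cast (by omega : 1 ≤ d)
  obtain ⟨n, hn⟩ := exists_nat_ge (max 1 ((M : ℝ) * (d : ℝ) ^ (d - 2)))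
  have hn1 : (1 : ℝ) ≤ n := (le_max_left _ _).trans hn
  have hnM : (M : ℝ) * (d : ℝ) ^ (d - 2) ≤ n := (le_max_right _ _).trans hn
  set B : Finset (Fin d → ℤ) := Fintype.piFinset fun _ => Finset.Icc (-(n : ℤ)) n
  have hcard : (B.card : ℝ) = (2 * n + 1) ^ d := by
    have : B.card = (2 * n + 1) ^ d := by
      simp only [B, Fintype.card_piFinset, Int.card_Icc, Finset.prod_const, Finset.card_univ,
        Fintype.card_fin]
      congr 1; omega
    rw [this]; push_cast; ring
  have hsum : (M : ℝ) ≤ ∑ x ∈ B, powNorm x := by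
    calc (M : ℝ) ≤ n / (d : ℝ) ^ (d - 2) := by rw [le_div_iff₀ (by positivity)]; exact hnM
      _ ≤ (n : ℝ) ^ 2 / (d : ℝ) ^ (d - 2) := by gcongr; nlinarith
      _ = (n : ℝ) ^ d * ((d * n : ℝ) ^ (d - 2))⁻¹ := by
          have : d = 2 + (d - 2) := by omega
          conv_rhs => rw [mul_pow, mul_inv]; enter [1]; rw [this, pow_add]
          field_simp
      _ ≤ B.card * ((d * n : ℝ) ^ (d - 2))⁻¹ := by
          rw [hcard]; gcongr; linarith
      _ = ∑ _x ∈ B, ((d * n : ℝ) ^ (d - 2))⁻¹ := by rw [Finset.sum_const, nsmul_eq_mul]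
      _ ≤ ∑ x ∈ B, powNorm x := by
          refine Finset.sum_le_sum fun x hx => powNorm_ge hd (by exact_mod_cast hn1) fun i => ?_
          have := Fintype.mem_piFinset.1 hx i
          rw [Finset.mem_Icc] at this
          exact abs_le.2 this
  calc (M : ℝ≥0∞) = ENNReal.ofReal M := by simp
    _ ≤ ENNReal.ofReal (∑ x ∈ B, powNorm x) := ENNReal.ofReal_le_ofReal hsum
    _ = ∑ x ∈ B, ENNReal.ofReal (powNorm x) :=
        ENNReal.ofReal_sum_of_nonneg fun x _ => (powNorm_pos x).le
    _ ≤ _ := ENNReal.sum_le_tsum B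

/-- The integer points in Euclidean space. -/
def intLattice (d : ℕ) : Submodule ℤ (EuclideanSpace ℝ (Fin d)) :=
  Submodule.span ℤ (Set.range (EuclideanSpace.basisFun (Fin d) ℝ).toBasis)

instance : DiscreteTopology (intLattice d) := by unfold intLattice; infer_instance

instance : IsZLattice ℝ (intLattice d) := by unfold intLattice; infer_instance

lemma toLp_mem_intLattice (x : Fin d → ℤ) :
    (WithLp.toLp 2 (fun i => (x i : ℝ)) : EuclideanSpace ℝ (Fin d)) ∈ intLattice d := by
  refine ((EuclideanSpace.basisFun (Fin d) ℝ).toBasis.mem_span_iff_repr_mem ℤ _).2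
    fun i => ⟨x i, ?_⟩
  simp

lemma finrank_intLattice : Module.finrank ℤ (intLattice d) = d := by
  rw [ZLattice.rank ℝ (intLattice d)]; simp

lemma summable_intLattice {s : ℝ} (hs : s < -d) : Summable fun z : intLattice d => ‖z‖ ^ s :=
  ZLattice.summable_norm_rpow (intLattice d) s (by rw [finrank_intLattice]; exact hs)

lemma injective_toIntLattice : Function.Injective fun x : Fin d → ℤ =>
    (⟨_, toLp_mem_intLattice x⟩ : intLattice d) := by
  intro x y h
  have h1 := congrArg (fun z : intLattice d => (z : EuclideanSpace ℝ (Fin d))) h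
  funext i
  have h2 := congrArg (fun z : EuclideanSpace ℝ (Fin d) => z i) h1
  simpa using h2

lemma summable_euclNorm_rpow {s : ℝ} (hs : s < -d) :
    Summable fun x : Fin d → ℤ => euclNorm x ^ s := by
  have := (summable_intLattice hs).comp_injective injective_toIntLattice
  exact this

/-- The square root of `powNorm`, as an extended nonnegative real. -/
def sqrtPow (x : Fin d → ℤ) : ℝ≥0∞ := ENNReal.ofReal (√(powNorm x))

lemma sqrtPow_sq (x : Fin d → ℤ) : sqrtPow x ^ 2 = ENNReal.ofReal (powNorm x) := by
  rw [sqrtPow, ← ENNReal.ofReal_pow (Real.sqrt_nonneg _), Real.sq_sqrt (powNorm_pos x).le]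

/-- This is where `d > 6` is used in full: the summand decays with exponent `3 (d - 2) / 2`, which
exceeds `d` exactly when `d > 6`. -/
lemma tsum_sqrtPow_ne_top (hd : 6 < d) : ∑' x : Fin d → ℤ, sqrtPow x ^ 3 ≠ ∞ := by
  have hd' : (7 : ℝ) ≤ d := by exact_mod_cast hd
  have hs : (2 - d : ℝ) * (3 / 2) < -d := by linarith
  have hsum := summable_euclNorm_rpow hs
  -- The extra term covers the origin, where `powNorm` is `1` by convention but the real power of
  -- `0` is `0`.
  have hle : ∀ x : Fin d → ℤ, sqrtPow x ^ 3 ≤ ENNReal.ofReal (euclNorm x ^ ((2 - d : ℝ) * (3 / 2))) +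
      if x = 0 then 1 else 0 := by
    intro x
    by_cases hx : x = 0
    · simp [hx, sqrtPow, powNorm]
    · simp only [hx, if_false, add_zero]
      rw [sqrtPow, ← ENNReal.ofReal_pow (Real.sqrt_nonneg _)]
      refine ENNReal.ofReal_le_ofReal (le_of_eq ?_)
      have hpos := euclNorm_nonneg x
      rw [powNorm, if_neg hx, Real.sqrt_eq_rpow, ← Real.rpow_natCast, ← Real.rpow_mul (by positivity),
        ← Real.rpow_intCast, ← Real.rpow_mul hpos]
      congr 1
      push_cast; ring
  refine ne_top_of_le_ne_top ?_ (ENNReal.tsum_le_tsum hle)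
  rw [ENNReal.tsum_add, tsum_ite_eq]
  refine ENNReal.add_ne_top.2 ⟨?_, by simp⟩
  exact hsum.tsum_ofReal_ne_top

end PowNorm

/-! ### A growth estimate -/

/-- A sequence of polynomial growth that is nearly supermultiplicative grows at most linearly. -/
lemma linear_of_sq_le {v : ℕ → ℝ} {K A : ℝ} {l d : ℕ} (hK : 0 < K) (hA : 0 ≤ A)
    (h0 : ∀ r, 0 ≤ v r)
    (hsq : ∀ r, v r ^ 2 ≤ K * ((r + l + r : ℕ) + 1) * v (r + l + r))
    (hpoly : ∀ r, v r ≤ (A * r + 1) ^ d) :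
    ∀ r, 1 ≤ r → v r ≤ 12 * K * (1 + l) * r := by
  intro r hr
  have hr1 : (1 : ℝ) ≤ r := by exact_mod_cast hr
  have hl0 : (0 : ℝ) ≤ l := Nat.cast_nonneg l
  by_contra hcon
  push Not at hcon
  -- The shift by `l` turns `n ↦ n + l + n` into doubling of `n + l`. For `u k = v n / (6 * K * s
  -- k)`, `hsq` gives `u k ^ 2 ≤ u (k + 1)`, and `hcon` gives `u 0 ≥ 2`.
  set s : ℕ → ℝ := fun k => 2 ^ k * (r + l) with hs
  have hs1 : ∀ k, 1 ≤ s k := fun k => by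
    have : (1 : ℝ) ≤ 2 ^ k := one_le_pow₀ (by norm_num)
    simp only [hs]; nlinarith
  have key : ∀ k : ℕ, ∃ n : ℕ, (n : ℝ) + l = s k ∧ 2 ^ (2 ^ k) ≤ v n / (6 * K * s k) := by
    intro k
    induction k with
    | zero =>
      refine ⟨r, by simp [hs], ?_⟩
      rw [le_div_iff₀ (by have := hs1 0; positivity)]
      simp only [hs, pow_zero, one_mul, pow_one]
      have : 12 * K * (1 + l) * r ≥ 12 * K * (r + l) := by
        have : 0 ≤ 12 * K * (l * (r - 1)) := by
          have : 0 ≤ (r : ℝ) - 1 := by linarith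
          positivity
        nlinarith
      linarith
    | succ k ih =>
      obtain ⟨n, hn, hk⟩ := ih
      have hsk := hs1 k
      have hss : s (k + 1) = 2 * s k := by simp only [hs]; ring
      refine ⟨n + l + n, by rw [hss, ← hn]; push_cast; ring, ?_⟩
      have h1 := hsq n
      have h2 : ((n + l + n : ℕ) : ℝ) + 1 ≤ 3 * s k := by
        push_cast; rw [← hn] at hsk ⊢; have : (0 : ℝ) ≤ n := Nat.cast_nonneg n; linarith
      have h3 : v n ^ 2 ≤ 3 * K * s k * v (n + l + n) := by
        refine h1.trans (mul_le_mul_of_nonneg_right ?_ (h0 _))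
        nlinarith
      calc (2 : ℝ) ^ (2 ^ (k + 1)) = (2 ^ (2 ^ k)) ^ 2 := by rw [pow_succ 2 k, pow_mul]
        _ ≤ (v n / (6 * K * s k)) ^ 2 := by gcongr
        _ = v n ^ 2 / (6 * K * s k) ^ 2 := div_pow _ _ _
        _ ≤ 3 * K * s k * v (n + l + n) / (6 * K * s k) ^ 2 := by gcongr
        _ = v (n + l + n) / (6 * K * s (k + 1)) := by rw [hss]; field_simp; ring
  have hB : ∀ k : ℕ, (2 : ℝ) ^ (2 ^ k) ≤ ((A + 1) * (r + l)) ^ d / (6 * K) * (2 ^ k : ℝ) ^ d := by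
    intro k
    obtain ⟨n, hn, hk⟩ := key k
    have hsk := hs1 k
    have hns : (n : ℝ) ≤ s k := by linarith
    calc (2 : ℝ) ^ (2 ^ k) ≤ v n / (6 * K * s k) := hk
      _ ≤ v n / (6 * K * 1) := by gcongr; exact h0 n
      _ ≤ ((A + 1) * s k) ^ d / (6 * K) := by
          rw [mul_one]
          gcongr
          refine (hpoly n).trans ?_
          gcongr
          nlinarith
      _ = _ := by simp only [hs]; rw [mul_pow, mul_pow, mul_pow]; ring
  set B := ((A + 1) * (r + l)) ^ d / (6 * K)
  have hBpos : 0 < B := by positivity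
  -- The limit of `n ^ d / 2 ^ n` along `n = 2 ^ k` contradicts `hB`.
  have hlim := (tendsto_pow_const_div_const_pow_of_one_lt d (one_lt_two (α := ℝ))).comp
    (tendsto_pow_atTop_atTop_of_one_lt (one_lt_two (α := ℕ)))
  obtain ⟨k, hk⟩ := ((tendsto_order.1 hlim).2 B⁻¹ (by positivity)).exists
  have h2 := hB k
  simp only [Function.comp_apply, Nat.cast_pow, Nat.cast_ofNat] at hk
  rw [div_lt_iff₀ (by positivity), inv_mul_eq_div, lt_div_iff₀ hBpos] at hk
  linarith

/-! ### The intrinsic metric of the open graph -/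

section Metric

variable {V : Type*} {G : SimpleGraph V}

lemma openGraph_le (ω : G.edgeSet → Bool) : openGraph G ω ≤ G := by
  intro x y h
  exact ((SimpleGraph.fromEdgeSet_adj _).1 h).1.1

lemma mem_edgeSet_openGraph (ω : G.edgeSet → Bool) (e : G.edgeSet) :
    (e : Sym2 V) ∈ (openGraph G ω).edgeSet ↔ ω e = true := by
  rw [openGraph, SimpleGraph.edgeSet_fromEdgeSet]
  constructor
  · rintro ⟨⟨h, h'⟩, -⟩; exact h'
  · intro h
    exact ⟨⟨e.2, h⟩, fun hd => G.not_isDiag_of_mem_edgeSet e.2 hd⟩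

lemma mem_conn_iff_walk {ω : G.edgeSet → Bool} {r : ℕ} {x y : V} :
    ω ∈ conn G ∅ r x y ↔ ∃ p : (openGraph G ω).Walk x y, p.length ≤ r := by
  constructor
  · rintro ⟨p, hp, -, ho⟩
    refine ⟨p.transfer (openGraph G ω) fun e he => ?_, by simpa using hp⟩
    exact (mem_edgeSet_openGraph ω ⟨e, p.edges_subset_edgeSet he⟩).2 (ho _ he)
  · rintro ⟨p, hp⟩
    refine ⟨p.mapLe (openGraph_le ω), by simpa using hp, by simp, fun e he => ?_⟩
    rw [SimpleGraph.Walk.edges_mapLe_eq_edges] at he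
    exact (mem_edgeSet_openGraph ω e).1 (p.edges_subset_edgeSet he)

lemma mem_conn_iff_edist {ω : G.edgeSet → Bool} {r : ℕ} {x y : V} :
    ω ∈ conn G ∅ r x y ↔ (openGraph G ω).edist x y ≤ r := by
  rw [mem_conn_iff_walk]
  constructor
  · rintro ⟨p, hp⟩
    exact (SimpleGraph.edist_le p).trans (by exact_mod_cast hp)
  · intro h
    obtain ⟨p, hp⟩ := SimpleGraph.exists_walk_of_edist_ne_top
      (ne_top_of_le_ne_top (ENat.natCast_ne_top r) h)
    exact ⟨p, by rw [← hp] at h; exact_mod_cast h⟩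

lemma reachable_iff_conn {ω : G.edgeSet → Bool} {x y : V} :
    (openGraph G ω).Reachable x y ↔ ∃ r, ω ∈ conn G ∅ r x y :=
  ⟨fun ⟨p⟩ => ⟨p.length, mem_conn_iff_walk.2 ⟨p, le_rfl⟩⟩,
    fun ⟨_, hr⟩ => let ⟨p, _⟩ := mem_conn_iff_walk.1 hr; ⟨p⟩⟩

lemma intrinsicBall_eq (ω : G.edgeSet → Bool) (x : V) (r : ℕ) :
    intrinsicBall G ω x r = iball ω r x := by
  ext y; exact mem_conn_iff_edist.symm

lemma mem_intrinsicSphere {ω : G.edgeSet → Bool} {x y : V} {r : ℕ} :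
    y ∈ intrinsicSphere G ω x (r + 1) ↔ ω ∈ conn G ∅ (r + 1) x y \ conn G ∅ r x y := by
  rw [Set.mem_sdiff, mem_conn_iff_edist, mem_conn_iff_edist, not_le, intrinsicSphere,
    Set.mem_ofPred_eq, Nat.cast_add, Nat.cast_one, ← ENat.add_one_le_iff (ENat.natCast_ne_top r)]
  exact ⟨fun h => ⟨h.le, h.ge⟩, fun h => le_antisymm h.1 h.2⟩

end Metric

/-! ### Moments of random sets -/

section Moments

variable {Ω V : Type*} [MeasurableSpace Ω]

open Classical in
lemma encard_eq_tsum (s : Set V) : (s.encard : ℝ≥0∞) = ∑' y, if y ∈ s then 1 else 0 := by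
  rw [← ENNReal.tsum_set_one, tsum_subtype s (fun _ => (1 : ℝ≥0∞))]
  rfl

variable [Countable V]

lemma lintegral_encard (μ : Measure Ω) {S : Ω → Set V} (hS : ∀ y, MeasurableSet {ω | y ∈ S ω}) :
    ∫⁻ ω, ((S ω).encard : ℝ≥0∞) ∂μ = ∑' y, μ {ω | y ∈ S ω} := by
  classical
  simp_rw [encard_eq_tsum]
  rw [lintegral_tsum fun y => (Measurable.ite (hS y) measurable_const
    measurable_const).aemeasurable]
  refine tsum_congr fun y => ?_
  rw [← lintegral_indicator_one (hS y)]
  rfl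

lemma lintegral_encard_sq (μ : Measure Ω) {S : Ω → Set V}
    (hS : ∀ y, MeasurableSet {ω | y ∈ S ω}) :
    ∫⁻ ω, ((S ω).encard : ℝ≥0∞) ^ 2 ∂μ = ∑' x, ∑' y, μ ({ω | x ∈ S ω} ∩ {ω | y ∈ S ω}) := by
  classical
  have hprod : ∀ ω, ((S ω).encard : ℝ≥0∞) ^ 2 = ∑' x, ∑' y,
      ({ω | x ∈ S ω} ∩ {ω | y ∈ S ω}).indicator (1 : Ω → ℝ≥0∞) ω := by
    intro ω
    rw [sq, encard_eq_tsum, ← ENNReal.tsum_mul_right]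
    refine tsum_congr fun x => ?_
    rw [← ENNReal.tsum_mul_left]
    refine tsum_congr fun y => ?_
    by_cases hx : x ∈ S ω <;> by_cases hy : y ∈ S ω <;> simp [hx, hy]
  have hm : ∀ x y, Measurable
      (({ω | x ∈ S ω} ∩ {ω | y ∈ S ω}).indicator (1 : Ω → ℝ≥0∞)) := fun x y =>
    measurable_one.indicator ((hS x).inter (hS y))
  simp_rw [hprod]
  rw [lintegral_tsum fun x => (Measurable.tsum (hm x)).aemeasurable]
  refine tsum_congr fun x => ?_
  rw [lintegral_tsum fun y => (hm x y).aemeasurable]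
  exact tsum_congr fun y => lintegral_indicator_one ((hS x).inter (hS y))

/-- A form of the second moment method. -/
lemma lintegral_encard_le (μ : Measure Ω) {S : Ω → Set V}
    (hS : ∀ y, MeasurableSet {ω | y ∈ S ω}) {H : Set Ω} (hH : MeasurableSet H)
    (hSH : ∀ ω, (S ω).Nonempty → ω ∈ H) {a b : ℝ≥0∞} (hab : a * b = 1) :
    ∫⁻ ω, ((S ω).encard : ℝ≥0∞) ∂μ ≤ a * ∫⁻ ω, ((S ω).encard : ℝ≥0∞) ^ 2 ∂μ + b * μ H := by
  classical
  have hN : Measurable fun ω => ((S ω).encard : ℝ≥0∞) := by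
    simp_rw [encard_eq_tsum]
    exact Measurable.tsum fun y => Measurable.ite (hS y) measurable_const measurable_const
  rw [← lintegral_indicator_one hH, ← lintegral_const_mul _ (hN.pow_const 2),
    ← lintegral_const_mul _ (measurable_one.indicator hH),
    ← lintegral_add_left ((hN.pow_const 2).const_mul a)]
  refine lintegral_mono fun ω => ?_
  rcases (S ω).eq_empty_or_nonempty with h | h
  · simp [h]
  · rw [Set.indicator_of_mem (hSH ω h), Pi.one_apply, mul_one]
    -- Write `N` for the size. If `N ≤ b` the last term suffices; otherwise `N ≤ a * N ^ 2`, as `a *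
    -- b = 1`.
    rcases le_total ((S ω).encard : ℝ≥0∞) b with hb | hb
    · exact hb.trans le_add_self
    · refine le_trans ?_ le_self_add
      calc ((S ω).encard : ℝ≥0∞) = a * (b * (S ω).encard) := by rw [← mul_assoc, hab, one_mul]
        _ ≤ a * ((S ω).encard * (S ω).encard) := by gcongr
        _ = _ := by rw [sq]

end Moments

/-! ### The one-arm lower bound from two moments of an annulus -/

section SecondMoment

variable {V : Type*} {G : SimpleGraph V} [AddCommGroup V] [Countable V]

/-- In the tree-graph bound each of the three arms of the tripod sums to one factor `vol`. -/
lemma tsum_conn_inter_le (htr : ∀ a x y : V, G.Adj (x + a) (y + a) ↔ G.Adj x y) (p : I) (r : ℕ) :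
    ∑' x, ∑' y, prodBer G.edgeSet p (conn G ∅ r 0 x ∩ conn G ∅ r 0 y) ≤ vol G p r 0 ^ 3 := by
  calc _ ≤ ∑' x, ∑' y, ∑' z, cp G p r 0 z * (cp G p r z x * cp G p r z y) :=
        ENNReal.tsum_le_tsum fun x => ENNReal.tsum_le_tsum fun y => measure_conn_inter_le p r r 0 x y
    _ = ∑' z, cp G p r 0 z * ((∑' x, cp G p r z x) * ∑' y, cp G p r z y) := by
        simp_rw [← ENNReal.tsum_mul_right, ← ENNReal.tsum_mul_left]
        rw [ENNReal.tsum_comm (f := fun z x => ∑' y, cp G p r 0 z * (cp G p r z x * cp G p r z y))]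
        exact tsum_congr fun x => ENNReal.tsum_comm
    _ = ∑' z, cp G p r 0 z * (vol G p r 0 * vol G p r 0) := by
        refine tsum_congr fun z => ?_
        change _ * (vol G p r z * vol G p r z) = _
        rw [vol_shift htr]
    _ = _ := by rw [ENNReal.tsum_mul_right]; change vol G p r 0 * _ = _; ring

lemma add_le_vol_add {p : I} (h : ∀ R, 1 ≤ sph G p R 0) (m k : ℕ) :
    vol G p m 0 + k ≤ vol G p (m + k) 0 := by
  induction k with
  | zero => simp
  | succ k ih =>
    rw [← add_assoc m k 1, vol_succ]
    push_cast
    rw [← add_assoc]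
    exact add_le_add ih (h _)

/-- The one-arm estimate from the first two moments of the annulus. -/
lemma le_measure_sphere (htr : ∀ a x y : V, G.Adj (x + a) (y + a) ↔ G.Adj x y) {p : I}
    (h : ∀ R, 1 ≤ sph G p R 0) {C : ℝ} (hC : 0 < C)
    (hvol : ∀ r, 1 ≤ r → vol G p r 0 ≤ ENNReal.ofReal (C * r)) {r : ℕ} (hr : 1 ≤ r) :
    ENNReal.ofReal ((32 * C ^ 3)⁻¹ / r) ≤
      prodBer G.edgeSet p {ω | (intrinsicSphere G ω 0 r).Nonempty} := by
  obtain ⟨m, rfl⟩ : ∃ m, r = m + 1 := ⟨r - 1, by omega⟩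
  set μ := prodBer G.edgeSet p
  set H := {ω : G.edgeSet → Bool | (intrinsicSphere G ω 0 (m + 1)).Nonempty} with hHdef
  have hH : MeasurableSet H := by
    have : H = ⋃ y, conn G ∅ (m + 1) 0 y \ conn G ∅ m 0 y := by
      ext ω
      simp only [hHdef, Set.mem_ofPred_eq, Set.mem_iUnion, Set.Nonempty, mem_intrinsicSphere]
    rw [this]
    exact MeasurableSet.iUnion fun y =>
      (measurableSet_conn _ _ _ _).diff (measurableSet_conn _ _ _ _)
  -- The annulus of distances `m + 1` to `2 (m + 1)`; any path into it crosses the sphere of radius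
  -- `m + 1`.
  set S : (G.edgeSet → Bool) → Set V := fun ω =>
    {y | ω ∈ conn G ∅ (m + 1 + (m + 1)) 0 y \ conn G ∅ m 0 y}
  have hS : ∀ y, MeasurableSet {ω | y ∈ S ω} := fun y =>
    (measurableSet_conn _ _ _ _).diff (measurableSet_conn _ _ _ _)
  have hSH : ∀ ω, (S ω).Nonempty → ω ∈ H := by
    rintro ω ⟨y, hy, hy'⟩
    obtain ⟨v, hv, -⟩ := exists_sphere_conn_off hy hy'
    exact ⟨v, mem_intrinsicSphere.2 hv⟩
  have hfin : ∀ r, vol G p r 0 ≠ ∞ := fun r =>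
    ne_top_of_le_ne_top ENNReal.ofReal_ne_top
      ((vol_mono p (Nat.le_succ r) 0).trans (hvol (r + 1) (by omega)))
  have hfirst : ((m + 1 : ℕ) : ℝ≥0∞) ≤ ∫⁻ ω, ((S ω).encard : ℝ≥0∞) ∂μ := by
    rw [lintegral_encard μ hS]
    have h1 : vol G p (m + 1 + (m + 1)) 0 = vol G p m 0 + ∑' y, μ {ω | y ∈ S ω} := by
      rw [vol, vol, ← ENNReal.tsum_add]
      refine tsum_congr fun y => ?_
      rw [cp, cp, add_comm (prodBer G.edgeSet p _)]
      have h : conn G ∅ m 0 y ⊆ conn G ∅ (m + 1 + (m + 1)) 0 y := conn_mono_length (by omega) _ _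
      conv_lhs => rw [← Set.sdiff_union_of_subset h]
      exact measure_union Set.disjoint_sdiff_left (measurableSet_conn _ _ _ _)
    have h2 : vol G p m 0 + ((m + 1 : ℕ) : ℝ≥0∞) ≤ vol G p m 0 + ∑' y, μ {ω | y ∈ S ω} := by
      rw [← h1]
      exact (add_le_vol_add h m (m + 1)).trans (vol_mono p (by omega) 0)
    exact (ENNReal.add_le_add_iff_left (hfin m)).1 h2
  have hsecond : ∫⁻ ω, ((S ω).encard : ℝ≥0∞) ^ 2 ∂μ ≤
      ENNReal.ofReal ((C * (2 * (m + 1))) ^ 3) := by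
    rw [lintegral_encard_sq μ hS]
    calc _ ≤ ∑' x, ∑' y, μ (conn G ∅ (m + 1 + (m + 1)) 0 x ∩ conn G ∅ (m + 1 + (m + 1)) 0 y) :=
          ENNReal.tsum_le_tsum fun x => ENNReal.tsum_le_tsum fun y =>
            measure_mono fun ω hω => ⟨hω.1.1, hω.2.1⟩
      _ ≤ vol G p (m + 1 + (m + 1)) 0 ^ 3 := tsum_conn_inter_le htr p _
      _ ≤ ENNReal.ofReal (C * (m + 1 + (m + 1) : ℕ)) ^ 3 := by
          gcongr; exact hvol _ (by omega)
      _ = _ := by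
          rw [← ENNReal.ofReal_pow (by positivity)]
          congr 2; push_cast; ring
  set n : ℝ := m + 1 with hn
  have hnpos : 0 < n := by positivity
  -- Chosen so that the second moment term equals `n / 2` (`hsimp`), half the lower bound on the
  -- mean.
  set b : ℝ := 16 * C ^ 3 * n ^ 2 with hb
  have hbpos : 0 < b := by positivity
  have hab : ENNReal.ofReal b⁻¹ * ENNReal.ofReal b = 1 := by
    rw [← ENNReal.ofReal_mul (by positivity), inv_mul_cancel₀ hbpos.ne', ENNReal.ofReal_one]
  have hmain := hfirst.trans (lintegral_encard_le μ hS hH hSH hab)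
  have hmain2 : ENNReal.ofReal n ≤ ENNReal.ofReal (b⁻¹ * (C * (2 * n)) ^ 3 + b * (μ H).toReal) := by
    calc ENNReal.ofReal n = ((m + 1 : ℕ) : ℝ≥0∞) := by
          rw [← ENNReal.ofReal_natCast]; congr 1; push_cast; rfl
      _ ≤ _ := hmain
      _ ≤ ENNReal.ofReal b⁻¹ * ENNReal.ofReal ((C * (2 * n)) ^ 3) + ENNReal.ofReal b * μ H := by
          gcongr
      _ = _ := by
          rw [ENNReal.ofReal_add (by positivity) (by positivity),
            ENNReal.ofReal_mul (p := b⁻¹) (by positivity), ENNReal.ofReal_mul (p := b) hbpos.le,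
            ENNReal.ofReal_toReal (measure_ne_top μ H)]
  rw [ENNReal.ofReal_le_ofReal_iff (by positivity)] at hmain2
  have hsimp : b⁻¹ * (C * (2 * n)) ^ 3 = n / 2 := by
    rw [hb]; field_simp; norm_num
  rw [hsimp] at hmain2
  refine ENNReal.ofReal_le_of_le_toReal ?_
  have hcast : ((m + 1 : ℕ) : ℝ) = n := by push_cast; rfl
  rw [hcast, inv_eq_one_div, div_div, div_le_iff₀ (by positivity)]
  have h3 : n / 2 ≤ b * (μ H).toReal := by linarith
  have h4 : n * 1 ≤ n * ((μ H).toReal * (32 * C ^ 3 * n)) := by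
    rw [hb] at h3; nlinarith
  exact le_of_mul_le_mul_left h4 hnpos

end SecondMoment

/-! ### Critical percolation on a lattice -/

section Lattice

variable {d : ℕ} {G : SimpleGraph (Fin d → ℤ)}

lemma IsLattice.exists_range (hG : IsLattice G) :
    ∃ L : ℕ, ∀ x y : Fin d → ℤ, G.Adj x y → ∀ i, |y i - x i| ≤ L := by
  obtain ⟨L, hL⟩ := hG.bounded_range
  obtain ⟨n, hn⟩ := exists_nat_ge L
  refine ⟨n, fun x y h i => ?_⟩
  have h1 := (abs_le_euclNorm (y - x) i).trans ((hL y x h.symm).trans hn)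
  simp only [Pi.sub_apply] at h1
  exact_mod_cast h1

lemma abs_sub_le_of_walk {L : ℕ} (hL : ∀ x y : Fin d → ℤ, G.Adj x y → ∀ i, |y i - x i| ≤ L)
    {x y : Fin d → ℤ} (p : G.Walk x y) (i : Fin d) : |y i - x i| ≤ L * p.length := by
  induction p with
  | nil => simp
  | @cons u v w h q ih =>
    have h1 := hL _ _ h i
    have h2 : w i - u i = (w i - v i) + (v i - u i) := by ring
    rw [h2, SimpleGraph.Walk.length_cons]
    push_cast
    have := abs_add_le (w i - v i) (v i - u i)
    nlinarith

lemma iball_subset {L : ℕ} (hL : ∀ x y : Fin d → ℤ, G.Adj x y → ∀ i, |y i - x i| ≤ L)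
    (ω : G.edgeSet → Bool) (r : ℕ) (u : Fin d → ℤ) :
    iball ω r u ⊆ (Fintype.piFinset fun i => Finset.Icc (u i - (L * r : ℕ)) (u i + (L * r : ℕ)) :
      Finset (Fin d → ℤ)) := by
  rintro y ⟨p, hp, -⟩
  rw [Finset.mem_coe, Fintype.mem_piFinset]
  intro i
  have h1 := abs_sub_le_of_walk hL p i
  have h2 : (L * p.length : ℤ) ≤ (L * r : ℕ) := by
    push_cast
    have : (p.length : ℤ) ≤ r := by exact_mod_cast hp
    gcongr
  have h3 := abs_le.1 (h1.trans h2)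
  rw [Finset.mem_Icc]
  constructor <;> linarith [h3.1, h3.2]

/-- The a priori polynomial growth that `linear_of_sq_le` improves to linear growth. -/
lemma vol_le_pow {L : ℕ} (hL : ∀ x y : Fin d → ℤ, G.Adj x y → ∀ i, |y i - x i| ≤ L)
    (p : I) (r : ℕ) : vol G p r 0 ≤ ENNReal.ofReal ((2 * L * r + 1) ^ d) := by
  set B : Finset (Fin d → ℤ) :=
    Fintype.piFinset fun i => Finset.Icc ((0 : Fin d → ℤ) i - (L * r : ℕ)) ((0 : Fin d → ℤ) i + (L * r : ℕ))
  have hzero : ∀ y ∉ B, cp G p r 0 y = 0 := by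
    intro y hy
    have : conn G ∅ r 0 y = ∅ :=
      Set.eq_empty_of_forall_notMem fun ω hω => hy (iball_subset hL ω r 0 hω)
    rw [cp, this, measure_empty]
  rw [vol, tsum_eq_sum hzero]
  have hcard : B.card = (2 * L * r + 1) ^ d := by
    simp only [B, Fintype.card_piFinset, Int.card_Icc, Finset.prod_const, Finset.card_univ,
      Fintype.card_fin, Pi.zero_apply]
    congr 1
    rw [mul_assoc]; omega
  calc ∑ y ∈ B, cp G p r 0 y ≤ ∑ _y ∈ B, 1 := Finset.sum_le_sum fun y _ => cp_le_one p r 0 y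
    _ = ((2 * L * r + 1 : ℕ) : ℝ≥0∞) ^ d := by simp [hcard]
    _ = _ := by
      rw [ENNReal.ofReal_pow (by positivity), ← ENNReal.ofReal_natCast]
      congr 2; push_cast; rfl

lemma criticalMeasure_eq : criticalMeasure G = prodBer G.edgeSet (criticalProb G) := rfl

lemma cp_le_of_twoPoint {c : ℝ} (h : ∀ x y : Fin d → ℤ,
      (criticalMeasure G).real {ω | (openGraph G ω).Reachable x y} ≤ c * powNorm (x - y))
    (r : ℕ) (x y : Fin d → ℤ) :
    cp G (criticalProb G) r x y ≤ ENNReal.ofReal c * sqrtPow (x - y) ^ 2 := by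
  rw [sqrtPow_sq, ← ENNReal.ofReal_mul' (powNorm_pos _).le]
  have hsub : conn G ∅ r x y ⊆ {ω | (openGraph G ω).Reachable x y} := fun ω hω =>
    reachable_iff_conn.2 ⟨r, hω⟩
  refine (measure_mono hsub).trans ?_
  rw [← ENNReal.ofReal_toReal (measure_ne_top (prodBer G.edgeSet (criticalProb G)) _)]
  exact ENNReal.ofReal_le_ofReal (h x y)

/-- By monotone convergence `vol` tends to the sum of the two-point function, which the lower
estimate makes infinite. -/
lemma exists_lt_vol (hd : 6 < d) {c : ℝ} (hc : 0 < c) (h : ∀ x y : Fin d → ℤ, c * powNorm (x - y) ≤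
      (criticalMeasure G).real {ω | (openGraph G ω).Reachable x y}) {M : ℝ≥0∞} (hM : M ≠ ∞) :
    ∃ k, M < vol G (criticalProb G) k 0 := by
  set μ := prodBer G.edgeSet (criticalProb G)
  have hreach : ∀ y : Fin d → ℤ, ENNReal.ofReal c * ENNReal.ofReal (powNorm (0 - y)) ≤
      ⨆ k, cp G (criticalProb G) k 0 y := by
    intro y
    have hU : {ω | (openGraph G ω).Reachable 0 y} = ⋃ k, conn G ∅ k 0 y := by
      ext ω; simp [reachable_iff_conn]
    have hmono : Monotone fun k => conn G ∅ k 0 y := fun a b hab => conn_mono_length hab 0 y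
    have h1 : ⨆ k, cp G (criticalProb G) k 0 y = μ (⋃ k, conn G ∅ k 0 y) :=
      hmono.measure_iUnion.symm
    rw [h1, ← hU, ← ENNReal.ofReal_mul hc.le]
    exact ENNReal.ofReal_le_of_le_toReal (h 0 y)
  have hsum : ∑' y : Fin d → ℤ, ⨆ k, cp G (criticalProb G) k 0 y = ∞ := by
    refine top_unique ?_
    calc ∞ = ENNReal.ofReal c * ∑' y : Fin d → ℤ, ENNReal.ofReal (powNorm y) := by
          rw [tsum_powNorm_eq_top hd, ENNReal.mul_top (by simpa using hc)]
      _ = ∑' y : Fin d → ℤ, ENNReal.ofReal c * ENNReal.ofReal (powNorm (0 - y)) := by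
          rw [ENNReal.tsum_mul_left]
          congr 1
          exact ((Equiv.subLeft (0 : Fin d → ℤ)).tsum_eq
            (fun y => ENNReal.ofReal (powNorm y))).symm
      _ ≤ _ := ENNReal.tsum_le_tsum hreach
  have hlt : M < ∑' y : Fin d → ℤ, ⨆ k, cp G (criticalProb G) k 0 y := by
    rw [hsum]; exact hM.lt_top
  rw [ENNReal.tsum_eq_iSup_sum] at hlt
  obtain ⟨s, hs⟩ := lt_iSup_iff.1 hlt
  rw [ENNReal.finsetSum_iSup_of_monotone fun y => (fun a b hab => cp_mono _ hab 0 y)] at hs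
  obtain ⟨k, hk⟩ := lt_iSup_iff.1 hs
  exact ⟨k, hk.trans_le (ENNReal.sum_le_tsum s)⟩

/-- Three two-point bounds cost `C ^ 3`, hence the target `2⁻¹ / C ^ 3` for the triangle of powers.
These bounds ignore path lengths, and translating by `z` removes `z`, so one `w` serves all `r`,
`R`, `z`. -/
lemma exists_small_triangle (hd : 6 < d) {c : ℝ} (hc : 0 < c) (h : ∀ x y : Fin d → ℤ,
      (criticalMeasure G).real {ω | (openGraph G ω).Reachable x y} ≤ c * powNorm (x - y)) :
    ∃ w : Fin d → ℤ, ∀ (r R : ℕ) (z : Fin d → ℤ),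
      ∑' x, ∑' a, cp G (criticalProb G) r z x *
        (cp G (criticalProb G) R z a * cp G (criticalProb G) r (w + x) a) ≤ 2⁻¹ := by
  have : Nonempty (Fin d) := ⟨⟨0, by omega⟩⟩
  set C := ENNReal.ofReal c with hC
  have hC0 : C ^ 3 ≠ 0 := pow_ne_zero _ (by simpa [hC] using hc)
  have hCt : C ^ 3 ≠ ∞ := ENNReal.pow_ne_top ENNReal.ofReal_ne_top
  obtain ⟨w, hw⟩ := exists_triangle_le (sqrtPow (d := d)) (tsum_sqrtPow_ne_top hd)
    (η := 2⁻¹ / C ^ 3) (ENNReal.div_pos (by simp) hCt).ne'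
  refine ⟨w, fun r R z => ?_⟩
  set p := criticalProb G
  calc ∑' x, ∑' a, cp G p r z x * (cp G p R z a * cp G p r (w + x) a)
      ≤ ∑' x, ∑' a, C ^ 3 * (sqrtPow (x - z) ^ 2 *
          (sqrtPow (a - z) ^ 2 * sqrtPow (a - (w + x)) ^ 2)) := by
        refine ENNReal.tsum_le_tsum fun x => ENNReal.tsum_le_tsum fun a => ?_
        rw [cp_comm p r z x, cp_comm p R z a, cp_comm p r (w + x) a]
        calc _ ≤ (C * sqrtPow (x - z) ^ 2) * ((C * sqrtPow (a - z) ^ 2) *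
              (C * sqrtPow (a - (w + x)) ^ 2)) := by
              gcongr <;> exact cp_le_of_twoPoint h _ _ _
          _ = _ := by ring
    _ = C ^ 3 * ∑' x : Fin d → ℤ, ∑' a, sqrtPow (x - z) ^ 2 *
          (sqrtPow (a - z) ^ 2 * sqrtPow ((a - z) - (x - z) - w) ^ 2) := by
        simp_rw [ENNReal.tsum_mul_left]
        congr 1
        refine tsum_congr fun x => ?_
        congr 1
        refine tsum_congr fun a => ?_
        congr 3
        abel
    _ = C ^ 3 * ∑' x : Fin d → ℤ, ∑' a, sqrtPow x ^ 2 *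
          (sqrtPow a ^ 2 * sqrtPow (a - x - w) ^ 2) := by
        rw [← (Equiv.subRight z).tsum_eq (fun x => ∑' a, sqrtPow x ^ 2 *
          (sqrtPow a ^ 2 * sqrtPow (a - x - w) ^ 2))]
        congr 1
        refine tsum_congr fun x => ?_
        exact (Equiv.subRight z).tsum_eq (fun a => sqrtPow (x - z) ^ 2 *
          (sqrtPow a ^ 2 * sqrtPow (a - (x - z) - w) ^ 2))
    _ ≤ C ^ 3 * (2⁻¹ / C ^ 3) := by gcongr
    _ = 2⁻¹ := ENNReal.mul_div_cancel hC0 hCt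

/-- `IsLattice` does not ask that `G` be connected; a positive connection probability provides the
walk. -/
lemma exists_walk_of_twoPoint {c : ℝ} (hc : 0 < c) (h : ∀ x y : Fin d → ℤ, c * powNorm (x - y) ≤
      (criticalMeasure G).real {ω | (openGraph G ω).Reachable x y}) (w : Fin d → ℤ) :
    Nonempty (G.Walk 0 w) := by
  have hpos := (mul_pos hc (powNorm_pos (0 - w))).trans_le (h 0 w)
  have : {ω | (openGraph G ω).Reachable 0 w}.Nonempty := by
    by_contra hcon
    rw [Set.not_nonempty_iff_eq_empty] at hcon
    rw [hcon, measureReal_empty] at hpos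
    exact lt_irrefl _ hpos
  obtain ⟨ω, ⟨p⟩⟩ := this
  exact ⟨p.mapLe (openGraph_le ω)⟩

/-- Needed to divide by `op p ^ l`. If it failed, almost surely all edges would be closed and
distinct points never connected. -/
lemma op_criticalProb_ne_zero (hd : 6 < d) {c : ℝ} (hc : 0 < c)
    (h : ∀ x y : Fin d → ℤ, c * powNorm (x - y) ≤
      (criticalMeasure G).real {ω | (openGraph G ω).Reachable x y}) :
    op (criticalProb G) ≠ 0 := by
  classical
  intro h0
  have : Nonempty (Fin d) := ⟨⟨0, by omega⟩⟩
  obtain ⟨w, hw⟩ := exists_ne (0 : Fin d → ℤ)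
  set μ := prodBer G.edgeSet (criticalProb G)
  have hclosed : ∀ e : G.edgeSet, μ {ω | ω e = true} = 0 := by
    intro e
    have hm : MeasurableSet {ω : G.edgeSet → Bool | ω e = true} :=
      measurableSet_eq_fun (measurable_pi_apply e) measurable_const
    rw [← lintegral_indicator_one hm, lintegral_resample _ e (measurable_one.indicator hm), h0]
    simp
  have hpos := (mul_pos hc (powNorm_pos (0 - w))).trans_le (h 0 w)
  have hsub : {ω | (openGraph G ω).Reachable 0 w} ⊆ ⋃ e : G.edgeSet, {ω | ω e = true} := by
    intro ω hω
    obtain ⟨r, p, hp, -, ho⟩ := reachable_iff_conn.1 hω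
    cases p with
    | nil => exact absurd rfl hw
    | cons hadj q => exact Set.mem_iUnion.2 ⟨⟨s(0, _), hadj⟩, ho ⟨s(0, _), hadj⟩ (by simp)⟩
  have hzero : μ {ω | (openGraph G ω).Reachable 0 w} = 0 :=
    measure_mono_null hsub (measure_iUnion_null hclosed)
  rw [Measure.real, criticalMeasure_eq, hzero] at hpos
  simp at hpos

/-- The expected volume of intrinsic balls grows at most linearly. -/
lemma exists_vol_le (hd : 6 < d) (hG : IsLattice G) (h2pt : TwoPointEstimate G) :
    ∃ C : ℝ, 0 < C ∧ ∀ r, 1 ≤ r → vol G (criticalProb G) r 0 ≤ ENNReal.ofReal (C * r) := by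
  obtain ⟨c₁, c₂, hc₁, hc₂, h⟩ := h2pt
  obtain ⟨L, hL⟩ := hG.exists_range
  set p := criticalProb G
  have hfin : ∀ (ω : G.edgeSet → Bool) r u, (iball ω r u).Finite := fun ω r u =>
    (Finset.finite_toSet _).subset (iball_subset hL ω r u)
  have hne : ∀ r, vol G p r 0 ≠ ∞ := fun r =>
    ne_top_of_le_ne_top ENNReal.ofReal_ne_top (vol_le_pow hL p r)
  obtain ⟨w, hw⟩ := exists_small_triangle hd hc₂ fun x y => (h x y).2
  obtain ⟨q⟩ := exists_walk_of_twoPoint hc₁ (fun x y => (h x y).1) w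
  have hop := op_criticalProb_ne_zero hd hc₁ fun x y => (h x y).1
  have hopt : op p ≠ ∞ := ENNReal.ofReal_ne_top
  set l := q.length
  set t : ℝ := (op p).toReal ^ l with ht
  have htpos : 0 < t := pow_pos (ENNReal.toReal_pos hop hopt) _
  -- `vol_sq_le` gives the constant `2 * l / t`; using `l + 1` keeps `K` positive when `l = 0`.
  have hlin := linear_of_sq_le (v := fun r => (vol G p r 0).toReal) (K := 2 * (l + 1) / t)
    (A := 2 * L) (l := l) (d := d) (by positivity) (by positivity) (fun r => ENNReal.toReal_nonneg)
    (fun r => by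
      have h1 := vol_sq_le hG.translation hfin p q r (hne r) fun z => hw r _ z
      have h2 := ENNReal.toReal_mono (ENNReal.mul_ne_top (by simp) (ENNReal.mul_ne_top
        (ENNReal.mul_ne_top (by simp) (ENNReal.add_ne_top.2 ⟨ENNReal.natCast_ne_top _, by simp⟩))
        (hne _))) h1
      simp only [ENNReal.toReal_mul, ENNReal.toReal_pow, ENNReal.toReal_ofNat] at h2
      rw [ENNReal.toReal_add (ENNReal.natCast_ne_top _) (by simp)] at h2
      simp only [ENNReal.toReal_natCast, ENNReal.toReal_one] at h2
      have h3 : (0 : ℝ) ≤ ((r + l + r : ℕ) : ℝ) + 1 := by positivity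
      have h4 : 0 ≤ (vol G p (r + l + r) 0).toReal := ENNReal.toReal_nonneg
      rw [div_mul_eq_mul_div, div_mul_eq_mul_div, le_div_iff₀ htpos]
      nlinarith [mul_nonneg h3 h4])
    (fun r => by
      have := ENNReal.toReal_mono ENNReal.ofReal_ne_top (vol_le_pow hL p r)
      rwa [ENNReal.toReal_ofReal (by positivity)] at this)
  refine ⟨12 * (2 * (l + 1) / t) * (1 + l), by positivity, fun r hr => ?_⟩
  exact (ENNReal.le_ofReal_iff_toReal_le (hne r) (by positivity)).2 (hlin r hr)

end Lattice

end Perc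

end

theorem theorem1p3 (d : ℕ) (hd : 6 < d) (G : SimpleGraph (Fin d → ℤ)) (hG : Perc.IsLattice G)
    (h2pt : Perc.TwoPointEstimate G) :
    ∃ c : ℝ, 0 < c ∧
      (∀ r : ℕ, ENNReal.ofReal (c * r) ≤
        ∫⁻ ω, ((Perc.intrinsicBall G ω 0 r).encard : ℝ≥0∞) ∂(Perc.criticalMeasure G)) ∧
      (∀ r : ℕ, 1 ≤ r → ENNReal.ofReal (c / r) ≤
        Perc.criticalMeasure G {ω | (Perc.intrinsicSphere G ω 0 r).Nonempty}) := by
  obtain ⟨C, hC, hvol⟩ := Perc.exists_vol_le hd hG h2pt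
  obtain ⟨c₁, c₂, hc₁, -, h⟩ := h2pt
  obtain ⟨L, hL⟩ := hG.exists_range
  have hfin : ∀ (ω : G.edgeSet → Bool) r u, (Perc.iball ω r u).Finite := fun ω r u =>
    (Finset.finite_toSet _).subset (Perc.iball_subset hL ω r u)
  have hne : ∀ r, Perc.vol G (Perc.criticalProb G) r 0 ≠ ∞ := fun r =>
    ne_top_of_le_ne_top ENNReal.ofReal_ne_top (Perc.vol_le_pow hL _ r)
  have hsph : ∀ R, 1 ≤ Perc.sph G (Perc.criticalProb G) R 0 :=
    Perc.one_le_sph hfin 0 (fun s v => Perc.vol_shift hG.translation _ s v) hne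
      fun M hM => Perc.exists_lt_vol hd hc₁ (fun x y => (h x y).1) hM
  -- The volume bound holds with constant `1`, the one-arm bound with `(32 * C ^ 3)⁻¹`.
  refine ⟨min 1 (32 * C ^ 3)⁻¹, by positivity, fun r => ?_, fun r hr => ?_⟩
  · have hint : ∫⁻ ω, ((Perc.intrinsicBall G ω 0 r).encard : ℝ≥0∞) ∂(Perc.criticalMeasure G) =
        Perc.vol G (Perc.criticalProb G) r 0 := by
      simp_rw [Perc.intrinsicBall_eq]
      exact Perc.lintegral_encard _ fun y => Perc.measurableSet_conn _ _ _ _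
    rw [hint]
    calc ENNReal.ofReal (min 1 (32 * C ^ 3)⁻¹ * r) ≤ ENNReal.ofReal (r : ℝ) := by
          refine ENNReal.ofReal_le_ofReal ?_
          have : min 1 (32 * C ^ 3)⁻¹ ≤ 1 := min_le_left _ _
          have hr0 : (0 : ℝ) ≤ r := Nat.cast_nonneg r
          nlinarith
      _ = r := ENNReal.ofReal_natCast r
      _ ≤ Perc.vol G (Perc.criticalProb G) 0 0 + r := le_add_self
      _ ≤ _ := by simpa using Perc.add_le_vol_add hsph 0 r
  · refine le_trans (ENNReal.ofReal_le_ofReal ?_) (Perc.le_measure_sphere hG.translation hsph hC hvol hr)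
    gcongr
    exact min_le_right _ _
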